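/- Let $B$ be a real symmetric invertible $3\times 3$ matrix, let $Q(v)=vBv^{T}$, $v=(x_1,x_2,x_3)$, be the corresponding nondegenerate quadratic form, and let $\Delta_Q=\sum_{i,j}b^{ij}\partial_i\partial_j$, where $(b^{ij})=B^{-1}$. Let $V(d;\mathbb R)$ be the space of real homogeneous polynomials of degree $d$ in $x_1,x_2,x_3$, let $\mathrm{Har}_Q(d;\mathbb R)=V(d;\mathbb R)\cap\ker\Delta_Q$, and let $O_Q(3;\mathbb R)=\{U\in GL(3;\mathbb R): UBU^{T}=B\}$ act on polynomials by $P(v)\mapsto P(vU)$. For a complex matrix $A$ with $AA^{T}=B$ put $$\langle f,g\rangle_A=\operatorname{Re}\int_{S^2} f(vA^{-1})\,\overline{g(vA^{-1})}\,dm(v),$$ where $dm$ is the standard measure on the real unit sphere $S^2$. 1. For every $d\ge 0$ there is a direct sum decomposition $V(d;\mathbb R)=\bigoplus_{0\le k\le d/2}Q^k\cdot \mathrm{Har}_Q(d-2k;\mathbb R)$. Each summand is $O_Q(3;\mathbb R)$-invariant, and distinct summands are orthogonal with respect to $\langle\cdot,\cdot\rangle_A$ for every such $A$. 2. For every $c\in\mathbb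 R$ and every real polynomial $F$ there is a real polynomial $P$ with $\Delta_Q P=0$ that coincides with $F$ on $\{v\in\mathbb R^3: Q(v)=c\}$. 3. For every $c\in\mathbb R$ and all real polynomials $M$ and $N$, the Dirichlet problem $\Delta_Q P=M$, $P=N$ on $\{v\in\mathbb R^3:Q(v)=c\}$, has a real polynomial solution $P$. The solution is unique if $\{v\in\mathbb R^3:Q(v)=c\}$ contains a nonzero vector. 4. For every $d\ge 0$, every $P\in V(d;\mathbb R)$ admits a representation $$P=\operatorname{Re}\Big\{\sum_{0\le k\le d/2}\lambda_k\,Q^{\,d-k+\frac12}\,\nabla_{\mathbf u_{1,k}}\nabla_{\mathbf u_{2,k}}\cdots\nabla_{\mathbf u_{d-2k,k}}\big(Q^{-\frac12}\big)\Big\}$$ with vectors $\mathbf u_{j,k}\in\mathbb C^3$, where $\lambda_k=1$ for $2k<d$, and, if $d$ is even, $\lambda_{d/2}=\lambda$ is a real number. Here $\nabla_{\mathbf u}$ is the directional derivative of holomorphic functions on open subsets of $\mathbb C^3$, and the equality holds at every $v\in\mathbb R^3$ with $Q(v)\neq 0$ and for every holomorphic branch of $Q^{1/2}$ near $v$. 5.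 If $Q$ is positive definite, the vectors $\mathbf u_{j,k}$ in 4 can be chosen in $\mathbb R^3$, and the representation with real vectors is unique in the following sense. The number $\lambda$ (for even $d$) is determined by $P$. For each $k$ with $2k<d$ the tuple $(\mathbf u_{1,k},\dots,\mathbf u_{d-2k,k})$ is determined by $P$ up to reordering and rescaling of the vectors by real factors with product $1$, all tuples that contain the zero vector being identified with each other. -/

import Mathlib

open MvPolynomial MeasureTheory
open scoped Matrix ComplexConjugate

namespace QHarm

noncomputable section

/-- The quadratic form `Q(v) = v B vᵀ` as a polynomial in three variables. -/
def quadPoly (B : Matrix (Fin 3) (Fin 3) ℝ) : MvPolynomial (Fin 3) ℝ :=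
  ∑ i, ∑ j, C (B i j) * X i * X j

/-- The operator `Δ_Q = ∑ b^{ij} ∂_i ∂_j`, where `(b^{ij}) = B⁻¹`. -/
def lapl (B : Matrix (Fin 3) (Fin 3) ℝ) :
    MvPolynomial (Fin 3) ℝ →ₗ[ℝ] MvPolynomial (Fin 3) ℝ :=
  ∑ i, ∑ j, (B⁻¹ i j) • ((pderiv i).toLinearMap ∘ₗ (pderiv j).toLinearMap)

/-- `Har_Q(n; ℝ)`: the real homogeneous polynomials of degree `n` in the kernel of `Δ_Q`. -/
def harm (B : Matrix (Fin 3) (Fin 3) ℝ) (n : ℕ) : Submodule ℝ (MvPolynomial (Fin 3) ℝ) :=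
  homogeneousSubmodule (Fin 3) ℝ n ⊓ LinearMap.ker (lapl B)

/-- `Q^k · Har_Q(d - 2k; ℝ)` (used for `2k ≤ d` only). -/
def summand (B : Matrix (Fin 3) (Fin 3) ℝ) (d k : ℕ) :
    Submodule ℝ (MvPolynomial (Fin 3) ℝ) :=
  (harm B (d - 2 * k)).map (LinearMap.mulLeft ℝ (quadPoly B ^ k))

/-- `O_Q(3; ℝ)`: the group of the invertible `U` with `U B Uᵀ = B`. -/
def orthoGroup (B : Matrix (Fin 3) (Fin 3) ℝ) : Subgroup (GL (Fin 3) ℝ) where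
  carrier := {U | (U : Matrix (Fin 3) (Fin 3) ℝ) * B * (U : Matrix (Fin 3) (Fin 3) ℝ)ᵀ = B}
  one_mem' := by simp
  mul_mem' := by
    intro U V hU hV
    simp only [Set.mem_ofPred_eq, Units.val_mul, Matrix.transpose_mul] at *
    calc (U : Matrix (Fin 3) (Fin 3) ℝ) * V * B
          * ((V : Matrix (Fin 3) (Fin 3) ℝ)ᵀ * (U : Matrix (Fin 3) (Fin 3) ℝ)ᵀ)
        = U * (V * B * (V : Matrix (Fin 3) (Fin 3) ℝ)ᵀ) * (U : Matrix (Fin 3) (Fin 3) ℝ)ᵀ := by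
          simp only [Matrix.mul_assoc]
      _ = B := by rw [hV, hU]
  inv_mem' := by
    intro U hU
    simp only [Set.mem_ofPred_eq] at *
    have h1 : ((U⁻¹ : GL (Fin 3) ℝ) : Matrix (Fin 3) (Fin 3) ℝ) * U = 1 := by
      rw [← Units.val_mul]; simp
    have h2 : (U : Matrix (Fin 3) (Fin 3) ℝ)ᵀ
        * ((U⁻¹ : GL (Fin 3) ℝ) : Matrix (Fin 3) (Fin 3) ℝ)ᵀ = 1 := by
      rw [← Matrix.transpose_mul, h1, Matrix.transpose_one]
    set W : Matrix (Fin 3) (Fin 3) ℝ := ((U⁻¹ : GL (Fin 3) ℝ) : Matrix (Fin 3) (Fin 3) ℝ)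
    calc W * B * Wᵀ = W * (U * B * (U : Matrix (Fin 3) (Fin 3) ℝ)ᵀ) * Wᵀ := by rw [hU]
      _ = (W * U) * B * ((U : Matrix (Fin 3) (Fin 3) ℝ)ᵀ * Wᵀ) := by
          simp only [Matrix.mul_assoc]
      _ = B := by rw [h1, h2]; simp

/-- The action `P(v) ↦ P(v U)` on polynomials, `v` being a row vector. -/
def act (U : Matrix (Fin 3) (Fin 3) ℝ) :
    MvPolynomial (Fin 3) ℝ →ₗ[ℝ] MvPolynomial (Fin 3) ℝ :=
  (aeval fun j => ∑ i, C (U i j) * (X i : MvPolynomial (Fin 3) ℝ)).toLinearMap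

/-- `⟨f, g⟩ = Re ∫_{S²} f(v A⁻¹) · conj (g(v A⁻¹)) dm(v)`, where `dm` is the standard surface
measure on the unit sphere `S²`. -/
def sphereInner (A : Matrix (Fin 3) (Fin 3) ℂ) (f g : MvPolynomial (Fin 3) ℝ) : ℝ :=
  (∫ v : Metric.sphere (0 : EuclideanSpace ℝ (Fin 3)) 1,
    aeval ((fun i => (((v : EuclideanSpace ℝ (Fin 3)) i : ℝ) : ℂ)) ᵥ* A⁻¹) f *
      conj (aeval ((fun i => (((v : EuclideanSpace ℝ (Fin 3)) i : ℝ) : ℂ)) ᵥ* A⁻¹) g)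
    ∂((volume : Measure (EuclideanSpace ℝ (Fin 3))).toSphere)).re

/-- `s` is a single-valued holomorphic branch of `Q^{1/2}` on the open set `W ⊆ ℂ³ ∖ {Q = 0}`. -/
structure IsSqrtBranch (B : Matrix (Fin 3) (Fin 3) ℝ) (W : Set (Fin 3 → ℂ))
    (s : (Fin 3 → ℂ) → ℂ) : Prop where
  isOpen : IsOpen W
  analytic : AnalyticOnNhd ℂ s W
  sq_eq : ∀ w ∈ W, s w ^ 2 = aeval w (quadPoly B)
  ne_zero : ∀ w ∈ W, s w ≠ 0

/-- Branches exist near every point where `Q` does not vanish. -/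
theorem exists_isSqrtBranch (B : Matrix (Fin 3) (Fin 3) ℝ) (w : Fin 3 → ℂ)
    (hw : aeval w (quadPoly B) ≠ 0) : ∃ W s, w ∈ W ∧ IsSqrtBranch B W s := by
  set q : (Fin 3 → ℂ) → ℂ := fun z => aeval z (quadPoly B) with hq
  have hqa : ∀ z, AnalyticAt ℂ q z := by
    intro z
    have : q = fun z : Fin 3 → ℂ => ∑ i, ∑ j, (B i j : ℂ) * z i * z j := by
      funext z; simp [hq, quadPoly]
    rw [this]
    have hp : ∀ i : Fin 3, AnalyticAt ℂ (fun z : Fin 3 → ℂ => z i) z := fun i =>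
      (ContinuousLinearMap.proj (R := ℂ) (φ := fun _ : Fin 3 => ℂ) i).analyticAt z
    refine Finset.analyticAt_fun_sum _ fun i _ => Finset.analyticAt_fun_sum _ fun j _ => ?_
    exact (analyticAt_const.mul (hp i)).mul (hp j)
  obtain ⟨c, hc⟩ : ∃ c : ℂ, c ^ 2 = q w := by
    obtain ⟨c, hc⟩ := IsAlgClosed.exists_pow_nat_eq (q w) (n := 2) (by norm_num)
    exact ⟨c, hc⟩
  have hc0 : c ≠ 0 := by
    rintro rfl
    exact hw (by simpa using hc.symm)
  have hqc : Continuous q := continuous_iff_continuousAt.2 fun z => (hqa z).continuousAt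
  have key : ∀ z, q z / q w ∈ Complex.slitPlane →
      (c * Complex.exp (Complex.log (q z / q w) / 2)) ^ 2 = q z := by
    intro z hz
    rw [mul_pow, ← Complex.exp_nat_mul, hc]
    have : ((2 : ℕ) : ℂ) * (Complex.log (q z / q w) / 2) = Complex.log (q z / q w) := by
      push_cast; ring
    rw [this, Complex.exp_log (Complex.slitPlane_ne_zero hz)]
    exact mul_div_cancel₀ (q z) hw
  refine ⟨{z | q z / q w ∈ Complex.slitPlane},
    fun z => c * Complex.exp (Complex.log (q z / q w) / 2), ?_, ?_, ?_, ?_, ?_⟩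
  · simp only [Set.mem_ofPred_eq]
    rw [div_self hw]
    exact Complex.one_mem_slitPlane
  · exact Complex.isOpen_slitPlane.preimage (hqc.div_const _)
  · intro z hz
    have h1 : AnalyticAt ℂ (fun z => q z / q w) z := (hqa z).div analyticAt_const hw
    exact analyticAt_const.mul ((h1.clog hz).div analyticAt_const (by norm_num)).cexp
  · exact fun z hz => key z hz
  · intro z hz
    exact mul_ne_zero hc0 (Complex.exp_ne_zero _)

/-- `∇_{u_1} ∇_{u_2} ⋯ ∇_{u_n} f` for the list `[u_1, …, u_n]` of vectors of `ℂ³`. -/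
def iterDir (us : List (Fin 3 → ℂ)) (f : (Fin 3 → ℂ) → ℂ) : (Fin 3 → ℂ) → ℂ :=
  us.foldr (fun u g w => fderiv ℂ g w u) f

/-- The sum over `0 ≤ k ≤ d/2` of `Q^{d-k+1/2} ∇_{u_{1,k}} ⋯ ∇_{u_{d-2k,k}} (Q^{-1/2})`, computed
with the branch `s` of `Q^{1/2}`. The term without any derivative, which occurs for `d = 2k`, has
the numerical coefficient `lam` (it is equal to `lam * Q^{d/2}`). -/
def maxwellSum (d : ℕ) (u : (k : ℕ) → Fin (d - 2 * k) → Fin 3 → ℂ) (lam : ℝ)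
    (s : (Fin 3 → ℂ) → ℂ) (w : Fin 3 → ℂ) : ℂ :=
  ∑ k ∈ Finset.range (d / 2 + 1),
    (if 2 * k = d then (lam : ℂ) else 1) * s w ^ (2 * (d - k) + 1) *
      iterDir (List.ofFn (u k)) (fun z => (s z)⁻¹) w

/-- `P` is the real part of the Maxwell-type sum, at each real point off the cone `{Q = 0}` and for
each branch of `Q^{1/2}` around the point. -/
def MaxwellRep (B : Matrix (Fin 3) (Fin 3) ℝ) (d : ℕ) (P : MvPolynomial (Fin 3) ℝ)
    (u : (k : ℕ) → Fin (d - 2 * k) → Fin 3 → ℂ) (lam : ℝ) : Prop :=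
  ∀ (W : Set (Fin 3 → ℂ)) (s : (Fin 3 → ℂ) → ℂ), IsSqrtBranch B W s →
    ∀ v : Fin 3 → ℝ, (fun i => (v i : ℂ)) ∈ W →
      eval v P = (maxwellSum d u lam s (fun i => (v i : ℂ))).re

/-- Two `n`-tuples of real vectors are the same multipole: they differ by a reordering and by
rescalings with factors of product `1`, or each of them contains the zero vector. -/
def SameMultipole {n : ℕ} (u u' : Fin n → Fin 3 → ℝ) : Prop :=
  ((∃ j, u j = 0) ∧ (∃ j, u' j = 0)) ∨
    ∃ (σ : Equiv.Perm (Fin n)) (t : Fin n → ℝ), ∏ j, t j = 1 ∧ ∀ j, u' j = t j • u (σ j)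

end

end QHarm

/-! Write Δ for `lap B` and Q for `qf B`. Everything rests on `lap_qf_pow_mul`: for a harmonic form
H of degree n, Δ(Q^(k+1) H) is a nonzero multiple of Q^k H. Hence the summands Q^k·Har lie in
eigenspaces of P ↦ QΔP. In a fixed degree d their eigenvalues 2k(2d-2k+1) are distinct, so the
summands are independent. They span because ΔP can be decomposed in degree d-2 and lifted term by
term. Equivariance of Δ gives invariance. For orthogonality, the substitution A⁻¹ turns Q into the
sum of squares, which is 1 on the sphere. Harmonic forms of different degrees are then orthogonal by
Green's identity, carried out with a Gaussian weight and transferred to the sphere in polar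
coordinates.

For the Dirichlet problem one seeks P = N + (Q-c)R. The map R ↦ Δ((Q-c)R) is bijective on
polynomials: triangular on the chains Q^k h, hence onto, and injective by looking at the leading
form. Uniqueness also needs that a polynomial vanishing on {Q = c} is divisible by Q-c. A nonzero
real point of the quadric provides an open patch on which one coordinate is ± a nonzero square root,
and division with remainder in that coordinate applies.

For the Maxwell representation, Q^(n+1/2) ∇_{u_1}⋯∇_{u_n} Q^(-1/2) is a harmonic form congruent
modulo Q to a nonzero constant times the product of the linear forms u_j B xᵀ. A harmonic form is
determined by its class modulo Q, that is, by its restriction to the complex cone Q = 0. After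
normalization of Q the cone is parametrized by quadratic polynomials in t, so a form of degree n
restricts to a polynomial in t of degree at most 2n. Splitting this polynomial into n quadratic
factors gives the vectors. If Q is positive definite, a real form restricts to a polynomial
compatible with t ↦ -1/conj t. Its roots come in antipodal pairs, each pair fixes a real vector up
to a real scalar, and comparison of roots gives uniqueness. -/

namespace QHarm

/-! ### Product rules for Δ and the basic identity for Δ(Q^k H) -/

section Algebra

variable {K : Type*} [Field K]

/-- The quadratic form `v B vᵀ` over a field. -/
noncomputable def qf (B : Matrix (Fin 3) (Fin 3) K) : MvPolynomial (Fin 3) K :=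
  ∑ i, ∑ j, C (B i j) * X i * X j

/-- The second order operator `∑ b^{ij} ∂_i ∂_j` with `(b^{ij}) = B⁻¹`. -/
noncomputable def lap (B : Matrix (Fin 3) (Fin 3) K) :
    MvPolynomial (Fin 3) K →ₗ[K] MvPolynomial (Fin 3) K :=
  ∑ i, ∑ j, (B⁻¹ i j) • ((pderiv i).toLinearMap ∘ₗ (pderiv j).toLinearMap)

/-- Substitution `P(v) ↦ P(v U)`. -/
noncomputable def subst (U : Matrix (Fin 3) (Fin 3) K) :
    MvPolynomial (Fin 3) K →ₐ[K] MvPolynomial (Fin 3) K :=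
  aeval fun j => ∑ i, C (U i j) * X i

/-- The linear form `u B xᵀ`. -/
noncomputable def linForm (B : Matrix (Fin 3) (Fin 3) K) (u : Fin 3 → K) : MvPolynomial (Fin 3) K :=
  ∑ j, C ((u ᵥ* B) j) * X j

/-- The directional derivative along `u`. -/
noncomputable def dirD (u : Fin 3 → K) : MvPolynomial (Fin 3) K →ₗ[K] MvPolynomial (Fin 3) K :=
  ∑ i, u i • (pderiv i).toLinearMap

theorem lap_apply (B : Matrix (Fin 3) (Fin 3) K) (P : MvPolynomial (Fin 3) K) :
    lap B P = ∑ i, ∑ j, C (B⁻¹ i j) * pderiv i (pderiv j P) := by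
  simp [lap, LinearMap.sum_apply, smul_eq_C_mul]

theorem dirD_apply (u : Fin 3 → K) (P : MvPolynomial (Fin 3) K) :
    dirD u P = ∑ i, C (u i) * pderiv i P := by
  simp [dirD, LinearMap.sum_apply, smul_eq_C_mul]

theorem dirD_mul (u : Fin 3 → K) (P R : MvPolynomial (Fin 3) K) :
    dirD u (P * R) = dirD u P * R + P * dirD u R := by
  simp only [dirD_apply, pderiv_mul, Finset.sum_mul, Finset.mul_sum, ← Finset.sum_add_distrib]
  exact Finset.sum_congr rfl fun i _ => by ring

theorem isHomogeneous_qf (B : Matrix (Fin 3) (Fin 3) K) : (qf B).IsHomogeneous 2 := by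
  refine IsHomogeneous.sum _ _ _ fun i _ => IsHomogeneous.sum _ _ _ fun j _ => ?_
  simpa using ((isHomogeneous_C (Fin 3) (B i j)).mul (isHomogeneous_X K i)).mul (isHomogeneous_X K j)

theorem isHomogeneous_linForm (B : Matrix (Fin 3) (Fin 3) K) (u : Fin 3 → K) :
    (linForm B u).IsHomogeneous 1 := by
  refine IsHomogeneous.sum _ _ _ fun j _ => ?_
  simpa using (isHomogeneous_C (Fin 3) _).mul (isHomogeneous_X K j)

theorem isHomogeneous_lap (B : Matrix (Fin 3) (Fin 3) K) {P : MvPolynomial (Fin 3) K} {n : ℕ}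
    (h : P.IsHomogeneous n) : (lap B P).IsHomogeneous (n - 2) := by
  rw [lap_apply]
  refine IsHomogeneous.sum _ _ _ fun i _ => IsHomogeneous.sum _ _ _ fun j _ => ?_
  have := (isHomogeneous_C (Fin 3) (B⁻¹ i j)).mul ((h.pderiv (i := j)).pderiv (i := i))
  rwa [zero_add, Nat.sub_sub] at this

theorem isHomogeneous_dirD (u : Fin 3 → K) {P : MvPolynomial (Fin 3) K} {n : ℕ}
    (h : P.IsHomogeneous n) : (dirD u P).IsHomogeneous (n - 1) := by
  rw [dirD_apply]
  refine IsHomogeneous.sum _ _ _ fun i _ => ?_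
  simpa using (isHomogeneous_C (Fin 3) (u i)).mul (h.pderiv (i := i))

theorem lap_eq_zero_of_lt_two (B : Matrix (Fin 3) (Fin 3) K) {P : MvPolynomial (Fin 3) K} {n : ℕ}
    (h : P.IsHomogeneous n) (hn : n < 2) : lap B P = 0 := by
  rw [lap_apply]
  refine Finset.sum_eq_zero fun i _ => Finset.sum_eq_zero fun j _ => ?_
  have h0 : (pderiv j P).IsHomogeneous 0 := by
    have := h.pderiv (i := j)
    rwa [show n - 1 = 0 by omega] at this
  rw [← totalDegree_zero_iff_isHomogeneous, totalDegree_eq_zero_iff_eq_C] at h0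
  rw [h0]; simp

theorem pderiv_linForm (B : Matrix (Fin 3) (Fin 3) K) (u : Fin 3 → K) (i : Fin 3) :
    pderiv i (linForm B u) = C ((u ᵥ* B) i) := by
  simp only [linForm, map_sum, pderiv_C_mul, pderiv_X]
  simp [Pi.single_apply]

theorem linForm_single (B : Matrix (Fin 3) (Fin 3) K) (i : Fin 3) :
    linForm B (Pi.single i 1) = ∑ j, C (B i j) * X j := by
  simp [linForm]

theorem pderiv_pderiv_comm (a b : Fin 3) (R : MvPolynomial (Fin 3) K) :
    pderiv a (pderiv b R) = pderiv b (pderiv a R) := by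
  have h : ⁅(pderiv a : Derivation K (MvPolynomial (Fin 3) K) (MvPolynomial (Fin 3) K)),
      (pderiv b : Derivation K (MvPolynomial (Fin 3) K) (MvPolynomial (Fin 3) K))⁆ = 0 := by
    refine derivation_ext fun i => ?_
    simp only [Derivation.commutator_apply, pderiv_X, Derivation.coe_zero, Pi.zero_apply]
    simp only [Pi.single_apply]
    split_ifs <;> simp
  have := congrArg (fun D : Derivation K (MvPolynomial (Fin 3) K) (MvPolynomial (Fin 3) K) => D R) h
  simpa [Derivation.commutator_apply, sub_eq_zero] using this

theorem pderiv_qf {B : Matrix (Fin 3) (Fin 3) K} (hB : B.IsSymm) (i : Fin 3) :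
    pderiv i (qf B) = 2 * linForm B (Pi.single i 1) := by
  have hs : ∀ a b, B a b = B b a := fun a b => hB.apply b a
  simp only [qf, linForm, map_sum, pderiv_mul, pderiv_C, pderiv_X, Finset.mul_sum]
  simp only [Pi.single_apply, Matrix.single_one_vecMul, Matrix.row]
  simp only [zero_mul, zero_add, Finset.sum_add_distrib]
  have e1 : ∑ x : Fin 3, ∑ y : Fin 3, C (B x y) * (if x = i then (1 : MvPolynomial (Fin 3) K) else 0) * X y
      = ∑ y, C (B i y) * X y := by
    rw [Finset.sum_eq_single i] <;> simp +contextual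
  have e2 : ∑ x : Fin 3, ∑ y : Fin 3, C (B x y) * X x * (if y = i then (1 : MvPolynomial (Fin 3) K) else 0)
      = ∑ y, C (B i y) * X y := by
    refine Finset.sum_congr rfl fun x _ => ?_
    rw [Finset.sum_eq_single i] <;> simp +contextual [hs x i]
  simp only [mul_ite, mul_one, mul_zero] at e1 e2 ⊢
  rw [e1, e2, ← Finset.sum_add_distrib]
  exact Finset.sum_congr rfl fun y _ => by ring

theorem dirD_qf {B : Matrix (Fin 3) (Fin 3) K} (hB : B.IsSymm) (u : Fin 3 → K) :
    dirD u (qf B) = 2 * linForm B u := by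
  simp only [dirD_apply, pderiv_qf hB, linForm_single]
  simp only [linForm, Matrix.vecMul, dotProduct, map_sum, map_mul, Finset.sum_mul, Finset.mul_sum]
  rw [Finset.sum_comm]
  exact Finset.sum_congr rfl fun j _ => Finset.sum_congr rfl fun i _ => by ring

theorem lap_mul (B : Matrix (Fin 3) (Fin 3) K) (hB : B.IsSymm) (P R : MvPolynomial (Fin 3) K) :
    lap B (P * R) = lap B P * R + 2 * ∑ i, ∑ j, C (B⁻¹ i j) * (pderiv i P * pderiv j R)
      + P * lap B R := by
  have hs : ∀ a b, B⁻¹ a b = B⁻¹ b a := fun a b => by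
    have : (B⁻¹).IsSymm := by rw [Matrix.IsSymm, Matrix.transpose_nonsing_inv, hB.eq]
    exact this.apply b a
  have e : ∑ i, ∑ j, C (B⁻¹ i j) * (pderiv j P * pderiv i R)
      = ∑ i, ∑ j, C (B⁻¹ i j) * (pderiv i P * pderiv j R) := by
    rw [Finset.sum_comm]
    exact Finset.sum_congr rfl fun i _ => Finset.sum_congr rfl fun j _ => by rw [hs]
  have e2 : lap B (P * R) = lap B P * R + (∑ i, ∑ j, C (B⁻¹ i j) * (pderiv i P * pderiv j R)
      + ∑ i, ∑ j, C (B⁻¹ i j) * (pderiv j P * pderiv i R)) + P * lap B R := by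
    simp only [lap_apply, pderiv_mul, map_add, Finset.sum_mul, Finset.mul_sum,
      ← Finset.sum_add_distrib]
    exact Finset.sum_congr rfl fun i _ => Finset.sum_congr rfl fun j _ => by ring
  rw [e2, e]; ring

/-- `∑ b^{ij} ∂_i ℓ_u ∂_j P = ∂_u P`. -/
theorem sum_inv_pderiv_linForm {B : Matrix (Fin 3) (Fin 3) K} (hdet : B.det ≠ 0) (u : Fin 3 → K)
    (P : MvPolynomial (Fin 3) K) :
    ∑ i, ∑ j, C (B⁻¹ i j) * (pderiv i (linForm B u) * pderiv j P) = dirD u P := by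
  simp only [pderiv_linForm, dirD_apply]
  rw [Finset.sum_comm]
  refine Finset.sum_congr rfl fun j _ => ?_
  have h : ((u ᵥ* B) ᵥ* B⁻¹) j = u j := by
    rw [Matrix.vecMul_vecMul, Matrix.mul_nonsing_inv _ (isUnit_iff_ne_zero.2 hdet),
      Matrix.vecMul_one]
  rw [← h, Matrix.vecMul, dotProduct, map_sum, Finset.sum_mul]
  exact Finset.sum_congr rfl fun i _ => by rw [map_mul]; ring

theorem lap_linForm (B : Matrix (Fin 3) (Fin 3) K) (u : Fin 3 → K) : lap B (linForm B u) = 0 :=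
  lap_eq_zero_of_lt_two B (isHomogeneous_linForm B u) one_lt_two

theorem lap_linForm_mul {B : Matrix (Fin 3) (Fin 3) K} (hB : B.IsSymm) (hdet : B.det ≠ 0)
    (u : Fin 3 → K) (P : MvPolynomial (Fin 3) K) :
    lap B (linForm B u * P) = 2 * dirD u P + linForm B u * lap B P := by
  rw [lap_mul B hB, lap_linForm, sum_inv_pderiv_linForm hdet]; ring

theorem lap_dirD (B : Matrix (Fin 3) (Fin 3) K) (u : Fin 3 → K) (P : MvPolynomial (Fin 3) K) :
    lap B (dirD u P) = dirD u (lap B P) := by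
  have h1 : ∀ i R, pderiv i (dirD u R) = dirD u (pderiv i R) := fun i R => by
    simp only [dirD_apply, map_sum, pderiv_C_mul, pderiv_pderiv_comm i]
  have h2 : ∀ a R, dirD u (C a * R) = C a * dirD u R := fun a R => by
    rw [← smul_eq_C_mul, map_smul, smul_eq_C_mul]
  simp only [lap_apply, h1, map_sum, h2]

/-- Since `pderiv j (qf B)` is twice `linForm B e_j`, this turns the cross term of Δ(QP) into the
Euler operator. -/
theorem sum_linForm_single {B : Matrix (Fin 3) (Fin 3) K} (i : Fin 3) (hdet : B.det ≠ 0) :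
    ∑ j, C (B⁻¹ i j) * linForm B (Pi.single j 1) = X i := by
  have h : ∀ k, ∑ j, B⁻¹ i j * B j k = (1 : Matrix (Fin 3) (Fin 3) K) i k := fun k => by
    rw [← Matrix.nonsing_inv_mul B (isUnit_iff_ne_zero.2 hdet), Matrix.mul_apply]
  simp only [linForm_single, Finset.mul_sum]
  rw [Finset.sum_comm]
  simp only [← mul_assoc, ← map_mul, ← Finset.sum_mul, ← map_sum, h]
  simp [Matrix.one_apply]

theorem inv_symm {B : Matrix (Fin 3) (Fin 3) K} (hB : B.IsSymm) (a b : Fin 3) :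
    B⁻¹ a b = B⁻¹ b a := by
  have : (B⁻¹).IsSymm := by rw [Matrix.IsSymm, Matrix.transpose_nonsing_inv, hB.eq]
  exact this.apply b a

/-- The cross term of the product rule gives 4nP by Euler's identity, and ΔQ = 6 because the trace
of B⁻¹B is 3. -/
theorem lap_qf_mul {B : Matrix (Fin 3) (Fin 3) K} (hB : B.IsSymm) (hdet : B.det ≠ 0)
    {P : MvPolynomial (Fin 3) K} {n : ℕ} (hP : P.IsHomogeneous n) :
    lap B (qf B * P) = (6 + 4 * n : ℕ) * P + qf B * lap B P := by
  have hd := isUnit_iff_ne_zero.2 hdet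
  have e1 : ∑ i, ∑ j, C (B⁻¹ i j) * (pderiv i (qf B) * pderiv j P) = 2 * (n * P) := by
    have := hP.sum_X_mul_pderiv
    rw [← nsmul_eq_mul, ← this, Finset.sum_comm, Finset.mul_sum]
    refine Finset.sum_congr rfl fun j _ => ?_
    rw [← sum_linForm_single j hdet, Finset.sum_mul, Finset.mul_sum]
    exact Finset.sum_congr rfl fun i _ => by rw [pderiv_qf hB, inv_symm hB]; ring
  have e2 : lap B (qf B) = 6 := by
    have h3 : ∀ i, ∑ j, C (B⁻¹ i j) * (C (B j i) : MvPolynomial (Fin 3) K) = 1 := fun i => by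
      simp only [← C_mul, ← map_sum]
      have := congrFun (congrFun (Matrix.nonsing_inv_mul B hd) i) i
      rw [Matrix.mul_apply, Matrix.one_apply_eq] at this
      rw [this, map_one]
    have h2 : ∀ i j, pderiv i (pderiv j (qf B)) = 2 * C (B j i) := fun i j => by
      rw [pderiv_qf hB, pderiv_mul, pderiv_linForm,
        show (2 : MvPolynomial (Fin 3) K) = C 2 from (map_ofNat C 2).symm, pderiv_C]
      simp
    rw [lap_apply]
    simp only [h2, mul_left_comm _ (2 : MvPolynomial (Fin 3) K), ← Finset.mul_sum, h3]
    simp; norm_num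
  rw [lap_mul B hB, e1, e2]; push_cast; ring

theorem lap_qf_pow_mul {B : Matrix (Fin 3) (Fin 3) K} (hB : B.IsSymm) (hdet : B.det ≠ 0)
    {P : MvPolynomial (Fin 3) K} {n : ℕ} (hP : P.IsHomogeneous n) (h0 : lap B P = 0) (k : ℕ) :
    lap B (qf B ^ (k + 1) * P) = (2 * (k + 1) * (2 * k + 2 * n + 3) : ℕ) * (qf B ^ k * P) := by
  induction k with
  | zero =>
    simp only [zero_add, pow_one, pow_zero, one_mul]
    rw [lap_qf_mul hB hdet hP, h0]; push_cast; ring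
  | succ k ih =>
    have hh : (qf B ^ (k + 1) * P).IsHomogeneous (2 * (k + 1) + n) :=
      ((isHomogeneous_qf B).pow (k + 1)).mul hP
    rw [pow_succ' _ (k + 1), mul_assoc, lap_qf_mul hB hdet hh, ih]
    push_cast; ring

end Algebra

/-! ### Linear changes of variables -/

section Substitution

variable {K : Type*} [Field K]

theorem eval_subst (U : Matrix (Fin 3) (Fin 3) K) (v : Fin 3 → K) (P : MvPolynomial (Fin 3) K) :
    eval v (subst U P) = eval (v ᵥ* U) P := by
  rw [subst, aeval_def, algebraMap_eq, ← coe_eval₂Hom, ← RingHom.comp_apply]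
  congr 1
  refine ringHom_ext (fun a => by simp) fun j => ?_
  simp [Matrix.vecMul, dotProduct, mul_comm]

theorem eval_qf (B : Matrix (Fin 3) (Fin 3) K) (v : Fin 3 → K) :
    eval v (qf B) = v ᵥ* B ⬝ᵥ v := by
  simp only [qf, map_sum, map_mul, eval_C, eval_X, Matrix.vecMul, dotProduct, Finset.sum_mul]
  rw [Finset.sum_comm]
  exact Finset.sum_congr rfl fun i _ => Finset.sum_congr rfl fun j _ => by ring

theorem eval_linForm (B : Matrix (Fin 3) (Fin 3) K) (u v : Fin 3 → K) :
    eval v (linForm B u) = u ᵥ* B ⬝ᵥ v := by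
  simp [linForm, dotProduct]

theorem subst_qf [CharZero K] (U B : Matrix (Fin 3) (Fin 3) K) :
    subst U (qf B) = qf (U * B * Uᵀ) := by
  refine MvPolynomial.funext fun v => ?_
  rw [eval_subst, eval_qf, eval_qf, ← Matrix.vecMul_vecMul, Matrix.vecMul_vecMul,
    ← Matrix.dotProduct_mulVec _ Uᵀ, Matrix.mulVec_transpose]

theorem isHomogeneous_subst (U : Matrix (Fin 3) (Fin 3) K) {P : MvPolynomial (Fin 3) K} {n : ℕ}
    (h : P.IsHomogeneous n) : (subst U P).IsHomogeneous n := by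
  have hj : ∀ j, (∑ i, C (U i j) * (X i : MvPolynomial (Fin 3) K)).IsHomogeneous 1 := fun j =>
    IsHomogeneous.sum _ _ _ fun i _ => by
      simpa using (isHomogeneous_C (Fin 3) (U i j)).mul (isHomogeneous_X K i)
  simpa [subst] using h.aeval _ hj

theorem pderiv_subst (U : Matrix (Fin 3) (Fin 3) K) (P : MvPolynomial (Fin 3) K) (i : Fin 3) :
    pderiv i (subst U P) = ∑ j, C (U i j) * subst U (pderiv j P) := by
  induction P using MvPolynomial.induction_on with
  | C a => simp [subst]
  | add p q hp hq => simp only [map_add, hp, hq, mul_add, Finset.sum_add_distrib]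
  | mul_X p k hp =>
    have hX : pderiv i (subst U (X k)) = C (U i k) := by
      simp only [subst, aeval_X, map_sum, pderiv_C_mul, pderiv_X]
      simp [Pi.single_apply]
    simp only [map_mul, pderiv_mul, hp, hX, map_add, mul_add, Finset.sum_add_distrib,
      Finset.sum_mul]
    congr 1
    · exact Finset.sum_congr rfl fun j _ => by ring
    · simp [pderiv_X, Pi.single_apply, apply_ite]
      ring

theorem subst_subst (U V : Matrix (Fin 3) (Fin 3) K) [CharZero K] (P : MvPolynomial (Fin 3) K) :
    subst U (subst V P) = subst (U * V) P := by
  refine MvPolynomial.funext fun v => ?_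
  rw [eval_subst, eval_subst, eval_subst, Matrix.vecMul_vecMul]

theorem subst_one [CharZero K] (P : MvPolynomial (Fin 3) K) :
    subst (1 : Matrix (Fin 3) (Fin 3) K) P = P := by
  refine MvPolynomial.funext fun v => ?_
  rw [eval_subst, Matrix.vecMul_one]

/-- The chain rule conjugates the coefficient matrix, and Uᵀ(UBUᵀ)⁻¹U = B⁻¹. This serves both the
invariance under the orthogonal group and the reduction to the sum of squares. -/
theorem lap_subst {U B : Matrix (Fin 3) (Fin 3) K} (hU : U.det ≠ 0)
    (P : MvPolynomial (Fin 3) K) :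
    lap (U * B * Uᵀ) (subst U P) = subst U (lap B P) := by
  have hu : IsUnit U.det := isUnit_iff_ne_zero.2 hU
  have hu' : IsUnit Uᵀ.det := by rwa [Matrix.det_transpose]
  have h1 : Uᵀ * (U * B * Uᵀ)⁻¹ * U = B⁻¹ := by
    rw [Matrix.mul_inv_rev, Matrix.mul_inv_rev, Matrix.mul_nonsing_inv_cancel_left _ _ hu',
      Matrix.mul_assoc, Matrix.nonsing_inv_mul _ hu, Matrix.mul_one]
  have h2 : ∀ j l, B⁻¹ j l = ∑ i, ∑ k, U i j * (U * B * Uᵀ)⁻¹ i k * U k l := fun j l => by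
    rw [← h1, Matrix.mul_apply, Finset.sum_comm]
    exact Finset.sum_congr rfl fun k _ => by
      rw [Matrix.mul_apply, Finset.sum_mul]; rfl
  simp only [lap_apply, pderiv_subst, map_sum, map_mul, pderiv_C_mul, h2, Finset.mul_sum,
    Finset.sum_mul]
  simp only [show ∀ a, subst U (C a) = C a from fun a => by simp [subst]]
  simp only [Fin.sum_univ_three]
  generalize (U * B * Uᵀ)⁻¹ = W
  ring

end Substitution

/-! ### Harmonic decomposition and the operator R ↦ Δ((Q-c)R) -/

section Decomposition

variable {K : Type*} [Field K]

/-- Homogeneous polynomials of degree `n` annihilated by `lap B`. -/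
structure IsHarm (B : Matrix (Fin 3) (Fin 3) K) (n : ℕ) (P : MvPolynomial (Fin 3) K) : Prop where
  hom : P.IsHomogeneous n
  lap_eq : lap B P = 0

theorem homogeneousComponent_map {L : MvPolynomial (Fin 3) K →ₗ[K] MvPolynomial (Fin 3) K}
    {m n : ℕ} (h1 : ∀ P, P.IsHomogeneous m → (L P).IsHomogeneous n)
    (h2 : ∀ j, j ≠ m → ∀ P, P.IsHomogeneous j → homogeneousComponent n (L P) = 0)
    (P : MvPolynomial (Fin 3) K) :
    homogeneousComponent n (L P) = L (homogeneousComponent m P) := by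
  have key : ∀ j, homogeneousComponent n (L (homogeneousComponent j P)) =
      if j = m then L (homogeneousComponent m P) else 0 := by
    intro j
    split_ifs with h
    · subst h
      exact homogeneousComponent_eq_self (h1 _ (homogeneousComponent_isHomogeneous _ _))
    · exact h2 j h _ (homogeneousComponent_isHomogeneous _ _)
  conv_lhs => rw [← sum_homogeneousComponent P]
  simp only [map_sum, key, Finset.sum_ite_eq', Finset.mem_range]
  split_ifs with h
  · rfl
  · rw [homogeneousComponent_eq_zero _ _ (by omega), map_zero]

theorem homogeneousComponent_lap (B : Matrix (Fin 3) (Fin 3) K) (n : ℕ) (P : MvPolynomial (Fin 3) K) :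
    homogeneousComponent n (lap B P) = lap B (homogeneousComponent (n + 2) P) := by
  refine homogeneousComponent_map (fun P hP => by simpa using isHomogeneous_lap B hP) ?_ P
  intro j hj P hP
  rcases lt_or_ge j 2 with h | h
  · rw [lap_eq_zero_of_lt_two B hP h, map_zero]
  · rw [homogeneousComponent_of_mem ((mem_homogeneousSubmodule _ _).2 (isHomogeneous_lap B hP)),
      if_neg (by omega)]

theorem homogeneousComponent_qf_mul (B : Matrix (Fin 3) (Fin 3) K) (n : ℕ) (P : MvPolynomial (Fin 3) K) :
    homogeneousComponent (n + 2) (qf B * P) = qf B * homogeneousComponent n P := by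
  refine homogeneousComponent_map (L := LinearMap.mulLeft K (qf B)) (fun P hP => ?_) ?_ P
  · rw [add_comm]; exact (isHomogeneous_qf B).mul hP
  · intro j hj P hP
    rw [LinearMap.mulLeft_apply, homogeneousComponent_of_mem
      ((mem_homogeneousSubmodule _ _).2 ((isHomogeneous_qf B).mul hP)), if_neg (by omega)]

variable [CharZero K] {B : Matrix (Fin 3) (Fin 3) K}

/-- Decompose ΔP by induction, lift each term through `lap_qf_pow_mul` to get R with ΔR = ΔP, and
note that P - R is harmonic. -/
theorem mem_span_qf_pow_mul (hB : B.IsSymm) (hdet : B.det ≠ 0) (d : ℕ) :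
    ∀ P : MvPolynomial (Fin 3) K, P.IsHomogeneous d →
      ∃ h : ℕ → MvPolynomial (Fin 3) K, (∀ k, 2 * k ≤ d → IsHarm B (d - 2 * k) (h k)) ∧
        P = ∑ k ∈ Finset.range (d / 2 + 1), qf B ^ k * h k := by
  induction d using Nat.strong_induction_on with
  | _ d ih =>
    intro P hP
    rcases lt_or_ge d 2 with hd | hd
    · refine ⟨fun _ => P, fun k hk => ?_, ?_⟩
      · obtain rfl : k = 0 := by omega
        exact ⟨by simpa using hP, lap_eq_zero_of_lt_two B hP hd⟩
      · rw [Nat.div_eq_of_lt hd]; simp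
    · obtain ⟨g, hg, hgs⟩ := ih (d - 2) (by omega) (lap B P) (isHomogeneous_lap B hP)
      -- The factor of `lap_qf_pow_mul` for a harmonic form of degree d-2-2k.
      set c : ℕ → ℕ := fun k => 2 * (k + 1) * (2 * k + 2 * (d - 2 - 2 * k) + 3) with hc
      have hc0 : ∀ k, (c k : K) ≠ 0 := fun k => by
        simp only [hc]; exact_mod_cast (by positivity : 2 * (k + 1) * (2 * k + 2 * (d - 2 - 2 * k) + 3) ≠ 0)
      have hrange : d / 2 + 1 = (d - 2) / 2 + 1 + 1 := by omega
      set R : MvPolynomial (Fin 3) K :=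
        ∑ k ∈ Finset.range ((d - 2) / 2 + 1), qf B ^ (k + 1) * (C (c k : K)⁻¹ * g k) with hR
      have hharm : ∀ k, 2 * k ≤ d - 2 → IsHarm B (d - 2 * (k + 1)) (C (c k : K)⁻¹ * g k) := by
        intro k hk
        obtain ⟨h1, h2⟩ := hg k hk
        refine ⟨?_, ?_⟩
        · rw [show d - 2 * (k + 1) = 0 + (d - 2 - 2 * k) by omega]
          exact (isHomogeneous_C _ _).mul h1
        · rw [← smul_eq_C_mul, map_smul, h2, smul_zero]
      have hRhom : R.IsHomogeneous d := by
        refine IsHomogeneous.sum _ _ _ fun k hk => ?_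
        rw [Finset.mem_range] at hk
        have := ((isHomogeneous_qf B).pow (k + 1)).mul (hharm k (by omega)).hom
        rwa [show 2 * (k + 1) + (d - 2 * (k + 1)) = d by omega] at this
      have hlapR : lap B R = lap B P := by
        rw [hgs, hR, map_sum]
        refine Finset.sum_congr rfl fun k hk => ?_
        rw [Finset.mem_range] at hk
        have h3 := hharm k (by omega)
        rw [lap_qf_pow_mul hB hdet h3.hom h3.lap_eq, show d - 2 * (k + 1) = d - 2 - 2 * k by omega,
          show 2 * (k + 1) * (2 * k + 2 * (d - 2 - 2 * k) + 3) = c k from rfl, ← map_natCast C]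
        have : (C (c k : K) * C (c k : K)⁻¹ : MvPolynomial (Fin 3) K) = 1 := by
          rw [← C_mul, mul_inv_cancel₀ (hc0 k), C_1]
        linear_combination (qf B ^ k * g k) * this
      refine ⟨fun k => if k = 0 then P - R else C (c (k - 1) : K)⁻¹ * g (k - 1), ?_, ?_⟩
      · intro k hk
        rcases k with _ | k
        · simpa using ⟨hP.sub hRhom, by rw [map_sub, hlapR, sub_self]⟩
        · simpa using hharm k (by omega)
      · rw [hrange, Finset.sum_range_succ']
        simp only [Nat.add_eq_zero_iff, one_ne_zero, and_false, if_false, Nat.add_sub_cancel,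
          if_true, pow_zero, one_mul]
        rw [← hR]; ring

theorem qf_mul_lap_qf_pow_mul (hB : B.IsSymm) (hdet : B.det ≠ 0) {d k : ℕ} (hk : 2 * k ≤ d)
    {h : MvPolynomial (Fin 3) K} (hh : IsHarm B (d - 2 * k) h) :
    qf B * lap B (qf B ^ k * h) = ((2 * k * (2 * d - 2 * k + 1) : ℕ) : K) • (qf B ^ k * h) := by
  rcases k with _ | k
  · simp [hh.lap_eq]
  · rw [lap_qf_pow_mul hB hdet hh.hom hh.lap_eq, smul_eq_C_mul, map_natCast,
      show 2 * k + 2 * (d - 2 * (k + 1)) + 3 = 2 * d - 2 * (k + 1) + 1 by omega, pow_succ]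
    ring

/-- The parabola 2k(2d+1-2k) has its vertex at k = (2d+1)/4, beyond d/2, so it increases strictly on
the range in question. -/
theorem eigenvalue_injective (d : ℕ) :
    Function.Injective fun k : Fin (d / 2 + 1) => ((2 * k * (2 * d - 2 * k + 1) : ℕ) : K) := by
  have key : ∀ a b : ℕ, a < b → 2 * b ≤ d →
      2 * a * (2 * d - 2 * a + 1) < 2 * b * (2 * d - 2 * b + 1) := by
    -- Writing b = a+f+1 and d = 2b+e removes the truncated subtractions.
    intro a b hab hb
    obtain ⟨e, rfl⟩ := Nat.exists_eq_add_of_le hb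
    obtain ⟨f, rfl⟩ := Nat.exists_eq_add_of_lt hab
    rw [show 2 * (2 * (a + f + 1) + e) - 2 * a + 1 = 2 * a + 4 * f + 5 + 2 * e by omega,
      show 2 * (2 * (a + f + 1) + e) - 2 * (a + f + 1) + 1 = 2 * a + 2 * f + 3 + 2 * e by omega]
    nlinarith
  intro a b hab
  simp only [Nat.cast_inj] at hab
  rcases lt_trichotomy (a : ℕ) b with h | h | h
  · exact absurd hab (key a b h (by omega)).ne
  · exact Fin.ext h
  · exact absurd hab (key b a h (by omega)).ne'

/-- The terms are eigenvectors of P ↦ QΔP for distinct eigenvalues, hence independent. -/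
theorem eq_zero_of_sum_qf_pow_mul (hB : B.IsSymm) (hdet : B.det ≠ 0) (d : ℕ)
    (h : ℕ → MvPolynomial (Fin 3) K) (hh : ∀ k, 2 * k ≤ d → IsHarm B (d - 2 * k) (h k))
    (h0 : ∑ k ∈ Finset.range (d / 2 + 1), qf B ^ k * h k = 0) (k : ℕ) (hk : 2 * k ≤ d) :
    qf B ^ k * h k = 0 := by
  have hind := (Module.End.eigenspaces_iSupIndep
    (LinearMap.mulLeft K (qf B) ∘ₗ lap B : Module.End K (MvPolynomial (Fin 3) K))).comp
      (eigenvalue_injective (K := K) d)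
  rw [iSupIndep_iff_finsetSum_eq_zero_imp_eq_zero] at hind
  rw [← Fin.sum_univ_eq_sum_range fun k => qf B ^ k * h k] at h0
  refine hind Finset.univ (fun i => qf B ^ (i : ℕ) * h i) (fun i _ => ?_) h0
    ⟨k, by omega⟩ (Finset.mem_univ _)
  rw [Function.comp_apply, Module.End.mem_eigenspace_iff]
  exact qf_mul_lap_qf_pow_mul hB hdet (by omega) (hh i (by omega))

/-- Otherwise ΔQ = 6 would vanish in characteristic zero. -/
theorem qf_ne_zero (hB : B.IsSymm) (hdet : B.det ≠ 0) : qf B ≠ 0 := by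
  intro h
  have := lap_qf_pow_mul hB hdet (isHomogeneous_one (Fin 3) K) (by rw [lap_apply]; simp) 0
  rw [h] at this
  norm_num at this

theorem harm_unique (hB : B.IsSymm) (hdet : B.det ≠ 0) (d : ℕ)
    (h g : ℕ → MvPolynomial (Fin 3) K) (hh : ∀ k, 2 * k ≤ d → IsHarm B (d - 2 * k) (h k))
    (hg : ∀ k, 2 * k ≤ d → IsHarm B (d - 2 * k) (g k))
    (h0 : ∑ k ∈ Finset.range (d / 2 + 1), qf B ^ k * h k =
      ∑ k ∈ Finset.range (d / 2 + 1), qf B ^ k * g k) (k : ℕ) (hk : 2 * k ≤ d) :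
    h k = g k := by
  have := eq_zero_of_sum_qf_pow_mul hB hdet d (fun k => h k - g k)
    (fun k hk => ⟨(hh k hk).hom.sub (hg k hk).hom, by
      rw [map_sub, (hh k hk).lap_eq, (hg k hk).lap_eq, sub_zero]⟩)
    (by simp only [mul_sub, Finset.sum_sub_distrib, h0, sub_self]) k hk
  exact sub_eq_zero.1 ((mul_eq_zero.1 this).resolve_left (pow_ne_zero _ (qf_ne_zero hB hdet)))

/-- `R ↦ Δ(QR)` is injective on forms. -/
theorem lap_qf_mul_injective (hB : B.IsSymm) (hdet : B.det ≠ 0) {d : ℕ}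
    {R : MvPolynomial (Fin 3) K} (hR : R.IsHomogeneous d) (h0 : lap B (qf B * R) = 0) : R = 0 := by
  obtain ⟨h, hh, rfl⟩ := mem_span_qf_pow_mul hB hdet d R hR
  set c : ℕ → ℕ := fun k => 2 * (k + 1) * (2 * k + 2 * (d - 2 * k) + 3) with hc
  -- Δ(Q·∑ Q^k h_k) = ∑ c_k Q^k h_k is again a harmonic decomposition, so its vanishing forces each
  -- c_k h_k = 0.
  have hz := harm_unique hB hdet d (fun k => C (c k : K) * h k) (fun _ => 0) (fun k hk => ⟨by
      rw [show d - 2 * k = 0 + (d - 2 * k) by omega]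
      exact (isHomogeneous_C _ _).mul (hh k hk).hom, by
      rw [← smul_eq_C_mul, map_smul, (hh k hk).lap_eq, smul_zero]⟩)
    (fun k hk => ⟨isHomogeneous_zero _ _ _, map_zero _⟩) (by
      rw [Finset.mul_sum, map_sum] at h0
      simp only [mul_zero, Finset.sum_const_zero]
      refine Eq.trans ?_ h0
      refine Finset.sum_congr rfl fun k hk => ?_
      rw [Finset.mem_range] at hk
      have := hh k (by omega)
      rw [← mul_assoc (qf B), ← pow_succ', lap_qf_pow_mul hB hdet this.hom this.lap_eq, map_natCast]
      ring)
  refine Finset.sum_eq_zero fun k hk => ?_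
  rw [Finset.mem_range] at hk
  have h1 := hz k (by omega)
  have h2 : (C (c k : K) : MvPolynomial (Fin 3) K) ≠ 0 := by
    rw [Ne, C_eq_zero]
    exact_mod_cast (by positivity : 2 * (k + 1) * (2 * k + 2 * (d - 2 * k) + 3) ≠ 0)
  rw [(mul_eq_zero.1 h1).resolve_left h2, mul_zero]

/-- The term cR only affects lower degrees, so the leading form of R satisfies Δ(Q·R_top) = 0 and
must be zero. -/
theorem eq_zero_of_lap_qf_sub_mul (hB : B.IsSymm) (hdet : B.det ≠ 0) (c : K)
    {R : MvPolynomial (Fin 3) K} (h : lap B ((qf B - C c) * R) = 0) : R = 0 := by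
  by_contra hR
  have h1 := congrArg (homogeneousComponent R.totalDegree) h
  rw [sub_mul, ← smul_eq_C_mul, map_sub, map_smul, map_sub, map_smul, homogeneousComponent_lap,
    homogeneousComponent_qf_mul, homogeneousComponent_lap,
    homogeneousComponent_eq_zero (R.totalDegree + 2) R (by omega), map_zero, smul_zero, sub_zero,
    map_zero] at h1
  have h2 := lap_qf_mul_injective hB hdet (homogeneousComponent_isHomogeneous _ _) h1
  -- A monomial of maximal degree shows that the leading form of a nonzero R is nonzero.
  obtain ⟨s, hs, hs'⟩ := Finset.exists_mem_eq_sup _ (support_nonempty.2 hR) fun s => s.sum fun _ e => e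
  have h3 : coeff s (homogeneousComponent R.totalDegree R) = coeff s R := by
    rw [coeff_homogeneousComponent, if_pos]
    rw [totalDegree, hs']; rfl
  rw [h2, coeff_zero] at h3
  exact mem_support_iff.1 hs h3.symm

/-- On a chain Q^k h with h harmonic the operator is triangular: a nonzero multiple of Q^k h minus a
multiple of Q^(k-1) h. Induction on k puts every such product in the range. -/
theorem exists_lap_qf_sub_mul_eq (hB : B.IsSymm) (hdet : B.det ≠ 0) (c : K)
    (M : MvPolynomial (Fin 3) K) : ∃ R, lap B ((qf B - C c) * R) = M := by
  set T : MvPolynomial (Fin 3) K →ₗ[K] MvPolynomial (Fin 3) K :=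
    lap B ∘ₗ LinearMap.mulLeft K (qf B - C c) with hT
  have key : ∀ k n h, IsHarm B n h → qf B ^ k * h ∈ LinearMap.range T := by
    intro k n h hh
    have hT1 : ∀ k, T (qf B ^ k * h) =
        ((2 * (k + 1) * (2 * k + 2 * n + 3) : ℕ) : K) • (qf B ^ k * h)
          - c • lap B (qf B ^ k * h) := fun k => by
      rw [hT, LinearMap.comp_apply, LinearMap.mulLeft_apply, sub_mul, map_sub, ← smul_eq_C_mul,
        map_smul, ← mul_assoc, ← pow_succ', lap_qf_pow_mul hB hdet hh.hom hh.lap_eq,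
        ← map_natCast (C : K →+* MvPolynomial (Fin 3) K), ← smul_eq_C_mul]
    have hT2 : ∀ k, lap B (qf B ^ k * h) ∈ LinearMap.range T →
        qf B ^ k * h ∈ LinearMap.range T := fun k hk => by
      have h1 := Submodule.add_mem _ (LinearMap.mem_range_self T (qf B ^ k * h))
        (Submodule.smul_mem _ c hk)
      rw [hT1, sub_add_cancel] at h1
      refine (Submodule.smul_mem_iff _ ?_).1 h1
      exact_mod_cast (by positivity : 2 * (k + 1) * (2 * k + 2 * n + 3) ≠ 0)
    induction k with
    | zero =>
      refine hT2 0 ?_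
      rw [pow_zero, one_mul, hh.lap_eq]
      exact Submodule.zero_mem _
    | succ k ih =>
      refine hT2 (k + 1) ?_
      rw [lap_qf_pow_mul hB hdet hh.hom hh.lap_eq, ← map_natCast C, ← smul_eq_C_mul]
      exact Submodule.smul_mem _ _ ih
  have : M ∈ LinearMap.range T := by
    rw [← sum_homogeneousComponent M]
    refine Submodule.sum_mem _ fun i _ => ?_
    obtain ⟨h, hh, e⟩ := mem_span_qf_pow_mul hB hdet i _ (homogeneousComponent_isHomogeneous i M)
    rw [e]
    exact Submodule.sum_mem _ fun k hk => key k _ _ (hh k (by rw [Finset.mem_range] at hk; omega))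
  exact this

end Decomposition

/-! ### Divisibility by the equation of a quadric -/

section Divisibility

variable {K : Type*} [Field K]

/-- Dividing by the monic polynomial y² - δ leaves a remainder ay + b. Vanishing at both y and -y
with y ≠ 0 kills a and b on a product of infinite sets, hence identically. -/
theorem dvd_of_eval_eq_zero [CharZero K] {P G : MvPolynomial (Fin 3) K} {δ : MvPolynomial (Fin 2) K}
    (hG : finSuccEquiv K 2 G = Polynomial.X ^ 2 - Polynomial.C δ) (S : Fin 2 → Set K)
    (hS : ∀ i, (S i).Infinite)
    (hP : ∀ x ∈ Set.pi Set.univ S, ∃ y : K, y ≠ 0 ∧ y ^ 2 = eval x δ ∧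
      eval (Fin.cons y x : Fin 3 → K) P = 0 ∧ eval (Fin.cons (-y) x : Fin 3 → K) P = 0) :
    G ∣ P := by
  set D : Polynomial (MvPolynomial (Fin 2) K) := Polynomial.X ^ 2 - Polynomial.C δ with hD
  have hDm : D.Monic := Polynomial.monic_X_pow_sub_C δ two_ne_zero
  have hDd : D.natDegree = 2 := Polynomial.natDegree_X_pow_sub_C
  set F := finSuccEquiv K 2 P with hF
  set r := F %ₘ D with hr
  have hrd : r.natDegree < 2 := by
    have := Polynomial.natDegree_modByMonic_lt F hDm (by
      intro h; rw [h, Polynomial.natDegree_one] at hDd; omega)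
    rwa [hDd] at this
  have hr2 : r = Polynomial.C (r.coeff 1) * Polynomial.X + Polynomial.C (r.coeff 0) :=
    Polynomial.eq_X_add_C_of_natDegree_le_one (by omega)
  have hdec : F = r + D * (F /ₘ D) := (Polynomial.modByMonic_add_div F D).symm
  have hev : ∀ x ∈ Set.pi Set.univ S, eval x (r.coeff 1) = 0 ∧ eval x (r.coeff 0) = 0 := by
    intro x hx
    obtain ⟨y, hy0, hy, h1, h2⟩ := hP x hx
    have key : ∀ z : K, z ^ 2 = eval x δ → eval (Fin.cons z x : Fin 3 → K) P = 0 →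
        eval x (r.coeff 1) * z + eval x (r.coeff 0) = 0 := by
      intro z hz hz0
      rw [eval_eq_eval_mv_eval', ← hF, hdec, hr2, hD] at hz0
      simpa [hz] using hz0
    have e1 := key y hy h1
    have e2 := key (-y) (by rw [neg_sq, hy]) h2
    have e3 : eval x (r.coeff 0) = 0 := by
      have : (2 : K) * eval x (r.coeff 0) = 0 := by linear_combination e1 + e2
      exact (mul_eq_zero.1 this).resolve_left two_ne_zero
    rw [e3, add_zero] at e1
    exact ⟨(mul_eq_zero.1 e1).resolve_right hy0, e3⟩
  have hr0 : r = 0 := by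
    have c1 : r.coeff 1 = 0 := funext_set S hS fun x hx => by rw [(hev x hx).1, map_zero]
    have c0 : r.coeff 0 = 0 := funext_set S hS fun x hx => by rw [(hev x hx).2, map_zero]
    rw [hr2, c1, c0]; simp
  have : D ∣ F := by rw [hdec, hr0, zero_add]; exact dvd_mul_right _ _
  rw [hF, ← hG] at this
  exact (map_dvd_iff (finSuccEquiv K 2)).1 this

theorem qf_diagonal (d : Fin 3 → K) :
    qf (Matrix.diagonal d) = C (d 0) * X 0 ^ 2 + C (d 1) * X 1 ^ 2 + C (d 2) * X 2 ^ 2 := by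
  simp [qf, Fin.sum_univ_three, Matrix.diagonal_apply]
  ring

theorem eval_qf_diagonal (d v : Fin 3 → K) :
    eval v (qf (Matrix.diagonal d)) = d 0 * v 0 ^ 2 + d 1 * v 1 ^ 2 + d 2 * v 2 ^ 2 := by
  simp [qf_diagonal]

/-- A polynomial vanishing at enough points of the quadric `d₀x₀² + d₁x₁² + d₂x₂² = c`
is divisible by the equation of the quadric. -/
theorem qf_diagonal_sub_dvd [CharZero K] {d : Fin 3 → K} (hd : d 0 ≠ 0) (c : K)
    {P : MvPolynomial (Fin 3) K} (S : Fin 2 → Set K) (hS : ∀ i, (S i).Infinite)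
    (hsq : ∀ x ∈ Set.pi Set.univ S, ∃ y : K, y ≠ 0 ∧ d 0 * y ^ 2 + d 1 * x 0 ^ 2 + d 2 * x 1 ^ 2 = c)
    (hP : ∀ x ∈ Set.pi Set.univ S, ∀ y, d 0 * y ^ 2 + d 1 * x 0 ^ 2 + d 2 * x 1 ^ 2 = c →
      eval (Fin.cons y x : Fin 3 → K) P = 0) :
    qf (Matrix.diagonal d) - C c ∣ P := by
  -- The value of x₀² on the quadric; dividing the equation by d₀ makes it monic in x₀.
  set δ : MvPolynomial (Fin 2) K :=
    C ((d 0)⁻¹) * (C c - C (d 1) * X 0 ^ 2 - C (d 2) * X 1 ^ 2) with hδ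
  have hG : finSuccEquiv K 2 (C ((d 0)⁻¹) * (qf (Matrix.diagonal d) - C c))
      = Polynomial.X ^ 2 - Polynomial.C δ := by
    have hC : ∀ a, finSuccEquiv K 2 (C a) = Polynomial.C (C a) := fun a => by
      simp [finSuccEquiv_apply]
    have h1 : (Polynomial.C (C ((d 0)⁻¹)) * Polynomial.C (C (d 0)) :
        Polynomial (MvPolynomial (Fin 2) K)) = 1 := by
      rw [← map_mul, ← map_mul, inv_mul_cancel₀ hd]; simp
    have hX1 : finSuccEquiv K 2 (X 1) = Polynomial.C (X 0) := finSuccEquiv_X_succ (j := 0)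
    have hX2 : finSuccEquiv K 2 (X 2) = Polynomial.C (X 1) := finSuccEquiv_X_succ (j := 1)
    rw [qf_diagonal]
    simp only [map_mul, map_sub, map_add, map_pow, hC, finSuccEquiv_X_zero, hX1, hX2, hδ]
    linear_combination Polynomial.X ^ 2 * h1
  have := dvd_of_eval_eq_zero hG S hS (P := P) fun x hx => by
    obtain ⟨y, hy0, hy⟩ := hsq x hx
    refine ⟨y, hy0, ?_, hP x hx y hy, hP x hx (-y) (by rw [neg_sq, hy])⟩
    simp only [hδ, map_mul, map_sub, map_pow, eval_C, eval_X]
    rw [← hy]; field_simp; ring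
  exact (dvd_mul_left _ _).trans this

end Divisibility

/-! ### Diagonalization and vanishing on a real quadric -/

section Diagonalization

theorem exists_diagonalization {B : Matrix (Fin 3) (Fin 3) ℝ} (hB : B.IsSymm) :
    ∃ (U : Matrix (Fin 3) (Fin 3) ℝ) (d : Fin 3 → ℝ), U.det ≠ 0 ∧
      U * B * Uᵀ = Matrix.diagonal d := by
  have hH : B.IsHermitian := by
    rw [Matrix.IsHermitian, Matrix.conjTranspose_eq_transpose_of_trivial, hB.eq]
  set V : Matrix (Fin 3) (Fin 3) ℝ := (hH.eigenvectorUnitary : Matrix (Fin 3) (Fin 3) ℝ) with hV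
  have hV1 : star V * V = 1 := Unitary.coe_star_mul_self hH.eigenvectorUnitary
  have hst : (star V)ᵀ = V := by
    rw [Matrix.star_eq_conjTranspose, Matrix.conjTranspose_eq_transpose_of_trivial,
      Matrix.transpose_transpose]
  refine ⟨star V, hH.eigenvalues, fun h => ?_, ?_⟩
  · have := congrArg Matrix.det hV1
    rw [Matrix.det_mul, h, zero_mul, Matrix.det_one] at this
    exact zero_ne_one this
  · have h := hH.spectral_theorem
    rw [Unitary.conjStarAlgAut_apply] at h
    rw [hst]
    conv_lhs => rw [h]
    simp only [← Matrix.mul_assoc, ← hV]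
    rw [hV1, Matrix.one_mul, Matrix.mul_assoc, hV1, Matrix.mul_one]
    rfl

theorem diagonal_ne_zero {K : Type*} [Field K] {U B : Matrix (Fin 3) (Fin 3) K} {d : Fin 3 → K}
    (hU : U.det ≠ 0) (hdet : B.det ≠ 0) (h : U * B * Uᵀ = Matrix.diagonal d) (i : Fin 3) :
    d i ≠ 0 := by
  have h1 := congrArg Matrix.det h
  rw [Matrix.det_mul, Matrix.det_mul, Matrix.det_transpose, Matrix.det_diagonal] at h1
  have h2 : ∏ i, d i ≠ 0 := by
    rw [← h1]; exact mul_ne_zero (mul_ne_zero hU hdet) hU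
  exact (Finset.prod_ne_zero_iff.1 h2) i (Finset.mem_univ i)

theorem dvd_of_subst_dvd {K : Type*} [Field K] [CharZero K] {U : Matrix (Fin 3) (Fin 3) K}
    (hU : U.det ≠ 0) {G P : MvPolynomial (Fin 3) K} (h : subst U G ∣ subst U P) : G ∣ P := by
  have h1 := map_dvd (subst U⁻¹) h
  rwa [subst_subst, subst_subst, Matrix.nonsing_inv_mul _ (isUnit_iff_ne_zero.2 hU), subst_one,
    subst_one] at h1

/-- A real polynomial vanishing on `{Q = c}` is divisible by `Q - c` if this quadric contains
a nonzero vector. -/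
theorem qf_sub_dvd_of_vanish {B : Matrix (Fin 3) (Fin 3) ℝ} (hB : B.IsSymm) (hdet : B.det ≠ 0)
    (c : ℝ) {v : Fin 3 → ℝ} (hv : v ≠ 0) (hvc : eval v (qf B) = c) {P : MvPolynomial (Fin 3) ℝ}
    (hP : ∀ v, eval v (qf B) = c → eval v P = 0) : qf B - C c ∣ P := by
  obtain ⟨U₀, d₀, hU₀, hd₀⟩ := exists_diagonalization hB
  obtain ⟨w₀, rfl⟩ : ∃ w, w ᵥ* U₀ = v := ⟨v ᵥ* U₀⁻¹, by
    rw [Matrix.vecMul_vecMul, Matrix.nonsing_inv_mul _ (isUnit_iff_ne_zero.2 hU₀),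
      Matrix.vecMul_one]⟩
  obtain ⟨i, hi⟩ : ∃ i, w₀ i ≠ 0 := by
    by_contra! h
    exact hv (by rw [show w₀ = 0 from funext h, Matrix.zero_vecMul])
  -- Reordering the coordinates makes the given point have x₀ ≠ 0.
  set σ : Equiv.Perm (Fin 3) := Equiv.swap 0 i with hσ
  set U : Matrix (Fin 3) (Fin 3) ℝ := U₀.submatrix σ id with hUdef
  set d := d₀ ∘ σ with hddef
  set w := w₀ ∘ σ with hwdef
  have hd : U * B * Uᵀ = Matrix.diagonal d := by
    have := congrArg (fun M => Matrix.submatrix M σ σ) hd₀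
    simp only [Matrix.submatrix_diagonal_equiv] at this
    rw [← this, hUdef]
    ext a b
    simp [Matrix.mul_apply]
  have hU : U.det ≠ 0 := by
    rw [hUdef, Matrix.det_permute]
    exact mul_ne_zero (by simp) hU₀
  have hw : w ᵥ* U = w₀ ᵥ* U₀ := by
    ext j
    simp only [Matrix.vecMul, dotProduct, hUdef, hwdef, Function.comp_apply, Matrix.submatrix_apply,
      id]
    exact Equiv.sum_comp σ fun k => w₀ k * U₀ k j
  have hw0 : w 0 ≠ 0 := by simpa [hwdef, hσ] using hi
  have hdz := diagonal_ne_zero hU hdet hd 0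
  have hev : ∀ x, eval x (qf (Matrix.diagonal d)) = eval (x ᵥ* U) (qf B) := fun x => by
    rw [← hd, ← subst_qf, eval_subst]
  apply dvd_of_subst_dvd hU
  rw [map_sub, subst_qf, hd, show subst U (C c) = C c by simp [subst]]
  -- The value of x₀² on the quadric. It is positive at the given point, hence on a product of
  -- intervals, where its square root supplies the required points.
  set g : (Fin 2 → ℝ) → ℝ := fun x => (c - d 1 * x 0 ^ 2 - d 2 * x 1 ^ 2) / d 0 with hg
  have hgc : Continuous g := by fun_prop
  have hgw : 0 < g ![w 1, w 2] := by
    have h1 := hev w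
    rw [hw, hvc, eval_qf_diagonal] at h1
    have : g ![w 1, w 2] = w 0 ^ 2 := by
      simp only [hg, ← h1]; simp; field_simp; ring
    rw [this]; positivity
  obtain ⟨ε, hε, hball⟩ := Metric.isOpen_iff.1 (isOpen_lt continuous_const hgc) _ hgw
  rw [ball_pi _ hε] at hball
  refine qf_diagonal_sub_dvd hdz c (fun b => Metric.ball (![w 1, w 2] b) ε) (fun i => ?_) (fun x hx => ?_) (fun x hx y hy => ?_)
  · rw [Real.ball_eq_Ioo]; exact Set.Ioo_infinite (by linarith)
  · have h0 : 0 < g x := hball hx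
    refine ⟨Real.sqrt (g x), (Real.sqrt_pos.2 h0).ne', ?_⟩
    rw [Real.sq_sqrt h0.le, hg]; field_simp; ring
  · rw [eval_subst]
    apply hP
    rw [← hev, eval_qf_diagonal]
    exact hy

theorem eq_zero_of_vanish {B : Matrix (Fin 3) (Fin 3) ℝ} (hB : B.IsSymm) (hdet : B.det ≠ 0)
    (c : ℝ) {v : Fin 3 → ℝ} (hv : v ≠ 0) (hvc : eval v (qf B) = c) {P : MvPolynomial (Fin 3) ℝ}
    (hl : lap B P = 0) (hP : ∀ v, eval v (qf B) = c → eval v P = 0) : P = 0 := by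
  obtain ⟨R, rfl⟩ := qf_sub_dvd_of_vanish hB hdet c hv hvc hP
  rw [eq_zero_of_lap_qf_sub_mul hB hdet c hl, mul_zero]

end Diagonalization

/-! ### The polynomials of Maxwell's representation -/

section Maxwell

variable {K : Type*} [Field K]

/-- The polynomial `Q^{n+1/2} ∇_{u_1} ⋯ ∇_{u_n} Q^{-1/2}`. -/
noncomputable def maxw (B : Matrix (Fin 3) (Fin 3) K) :
    List (Fin 3 → K) → MvPolynomial (Fin 3) K
  | [] => 1
  | u :: us => qf B * dirD u (maxw B us) - C (2 * us.length + 1 : K) * (linForm B u * maxw B us)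

/-- For H harmonic of degree n, Δ(Q ∂_u H) = (6+4(n-1)) ∂_u H and (2n+1) Δ(ℓ_u H) = 2(2n+1) ∂_u H,
where ℓ_u is `linForm B u`; both constants are 4n+2. -/
theorem isHarm_maxw {B : Matrix (Fin 3) (Fin 3) K} (hB : B.IsSymm) (hdet : B.det ≠ 0)
    (us : List (Fin 3 → K)) : IsHarm B us.length (maxw B us) := by
  induction us with
  | nil => exact ⟨isHomogeneous_one _ _, by simp [maxw, lap_apply]⟩
  | cons u us ih =>
    obtain ⟨h1, h2⟩ := ih
    -- One vector is treated apart, since the degree n-1 truncates at n = 0.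
    rcases us with _ | ⟨u', us⟩
    · have : maxw B [u] = -linForm B u := by simp [maxw, dirD_apply]
      rw [this]
      exact ⟨(isHomogeneous_linForm B u).neg, by rw [map_neg, lap_linForm, neg_zero]⟩
    · have hD := isHomogeneous_dirD u h1
      simp only [List.length_cons, Nat.add_sub_cancel] at hD h1 ⊢
      rw [maxw]
      set H := maxw B (u' :: us)
      refine ⟨IsHomogeneous.sub ?_ ?_, ?_⟩
      · rw [show us.length + 1 + 1 = 2 + us.length by ring]
        exact (isHomogeneous_qf B).mul hD
      · rw [show us.length + 1 + 1 = 0 + (1 + (us.length + 1)) by ring]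
        exact (isHomogeneous_C _ _).mul ((isHomogeneous_linForm B u).mul h1)
      · rw [map_sub, lap_qf_mul hB hdet hD, lap_dirD, h2, ← smul_eq_C_mul, map_smul,
          lap_linForm_mul hB hdet, h2, smul_eq_C_mul]
        simp only [List.length_cons, map_add, map_mul, map_natCast, map_ofNat, map_one, map_zero]
        push_cast
        ring

/-- `(-1)^n (2n-1)!!`. -/
def maxwCoeff (K : Type*) [Field K] (n : ℕ) : K := ∏ i ∈ Finset.range n, -(2 * i + 1 : K)

theorem maxwCoeff_ne_zero [CharZero K] (n : ℕ) : maxwCoeff K n ≠ 0 := by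
  refine Finset.prod_ne_zero_iff.2 fun i _ => neg_ne_zero.2 ?_
  exact_mod_cast (by omega : 2 * i + 1 ≠ 0)

/-- Modulo Q only the second term of the recursion survives, so each vector contributes a linear
form and an odd factor. -/
theorem qf_dvd_maxw_sub (B : Matrix (Fin 3) (Fin 3) K) (us : List (Fin 3 → K)) :
    qf B ∣ maxw B us - C (maxwCoeff K us.length) * (us.map (linForm B)).prod := by
  induction us with
  | nil => simp [maxw, maxwCoeff]
  | cons u us ih =>
    obtain ⟨R, hR⟩ := ih
    refine ⟨dirD u (maxw B us) - C (2 * us.length + 1 : K) * linForm B u * R, ?_⟩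
    have : maxwCoeff K (u :: us).length = maxwCoeff K us.length * -(2 * us.length + 1 : K) := by
      simp [maxwCoeff, Finset.prod_range_succ]
    rw [this, maxw, List.map_cons, List.prod_cons, map_mul, map_neg]
    linear_combination (-C (2 * us.length + 1 : K) * linForm B u) * hR

/-- A harmonic form is determined by its class modulo `Q`. -/
theorem IsHarm.eq_of_dvd_sub [CharZero K] {B : Matrix (Fin 3) (Fin 3) K} (hB : B.IsSymm)
    (hdet : B.det ≠ 0) {n : ℕ} {P R : MvPolynomial (Fin 3) K} (hP : IsHarm B n P)
    (hR : IsHarm B n R) (h : qf B ∣ P - R) : P = R := by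
  obtain ⟨S, hS⟩ := h
  -- The case c = 0 of the injectivity of S ↦ Δ((Q-c)S).
  have h0 : lap B ((qf B - C 0) * S) = 0 := by
    rw [map_zero, sub_zero, ← hS, map_sub, hP.lap_eq, hR.lap_eq, sub_zero]
  rw [eq_zero_of_lap_qf_sub_mul hB hdet 0 h0, mul_zero] at hS
  exact sub_eq_zero.1 hS

end Maxwell

/-! ### Analytic derivatives of branches of Q^(-1/2) -/

section Derivatives

/-- The differential of the polynomial function `P` at `w`. -/
noncomputable def gradAt (P : MvPolynomial (Fin 3) ℂ) (w : Fin 3 → ℂ) : (Fin 3 → ℂ) →L[ℂ] ℂ :=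
  ∑ i, eval w (pderiv i P) • (ContinuousLinearMap.proj i : (Fin 3 → ℂ) →L[ℂ] ℂ)

theorem gradAt_apply (P : MvPolynomial (Fin 3) ℂ) (w u : Fin 3 → ℂ) :
    gradAt P w u = eval w (dirD u P) := by
  simp [gradAt, dirD_apply, mul_comm]

theorem hasFDerivAt_eval (P : MvPolynomial (Fin 3) ℂ) (w : Fin 3 → ℂ) :
    HasFDerivAt (fun z : Fin 3 → ℂ => eval z P) (gradAt P w) w := by
  induction P using MvPolynomial.induction_on with
  | C a =>
    have h0 : gradAt (C a) w = 0 := by ext u; simp [gradAt_apply, dirD_apply]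
    simpa only [h0, eval_C] using hasFDerivAt_const (𝕜 := ℂ) a w
  | add p q hp hq =>
    simp only [map_add]
    refine (hp.fun_add hq).congr_fderiv ?_
    ext u
    simp [gradAt_apply]
  | mul_X p k hp =>
    have hk : HasFDerivAt (fun z : Fin 3 → ℂ => z k)
        (ContinuousLinearMap.proj k : (Fin 3 → ℂ) →L[ℂ] ℂ) w :=
      (ContinuousLinearMap.proj k : (Fin 3 → ℂ) →L[ℂ] ℂ).hasFDerivAt
    have hX : ∀ u : Fin 3 → ℂ, dirD u (X k) = C (u k) := fun u => by
      simp [dirD_apply, pderiv_X, Pi.single_apply]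
    simp only [map_mul, eval_X]
    refine (hp.fun_mul hk).congr_fderiv ?_
    ext u
    simp [gradAt_apply, dirD_mul, hX]
    ring

theorem fderiv_eval (P : MvPolynomial (Fin 3) ℂ) (w u : Fin 3 → ℂ) :
    fderiv ℂ (fun z : Fin 3 → ℂ => eval z P) w u = eval w (dirD u P) := by
  rw [(hasFDerivAt_eval P w).fderiv, gradAt_apply]

theorem map_qf (B : Matrix (Fin 3) (Fin 3) ℝ) :
    MvPolynomial.map (algebraMap ℝ ℂ) (qf B) = qf (B.map (algebraMap ℝ ℂ)) := by
  simp [qf]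

theorem aeval_quadPoly (B : Matrix (Fin 3) (Fin 3) ℝ) (w : Fin 3 → ℂ) :
    aeval w (quadPoly B) = eval w (qf (B.map (algebraMap ℝ ℂ))) := by
  rw [← map_qf, eval_map, aeval_def]; rfl

/-- Differentiating p·s^(-2n-1) and using s ∂_u s = ℓ_u, with ℓ_u as `linForm`, reproduces the
recursion of `maxw`. -/
theorem iterDir_inv_eq {B : Matrix (Fin 3) (Fin 3) ℝ} (hB : B.IsSymm) {W : Set (Fin 3 → ℂ)}
    {s : (Fin 3 → ℂ) → ℂ} (hs : IsSqrtBranch B W s) (us : List (Fin 3 → ℂ)) :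
    ∀ w ∈ W, iterDir us (fun z => (s z)⁻¹) w =
      eval w (maxw (B.map (algebraMap ℝ ℂ)) us) * (s w)⁻¹ ^ (2 * us.length + 1) := by
  set Bc := B.map (algebraMap ℝ ℂ) with hBc
  have hBs : Bc.IsSymm := hB.map _
  have hsd : ∀ w ∈ W, DifferentiableAt ℂ s w := fun w hw => (hs.analytic w hw).differentiableAt
  -- Obtained by differentiating s² = Q, which holds on a whole neighbourhood because W is open.
  have hds : ∀ w ∈ W, ∀ u, s w * fderiv ℂ s w u = eval w (linForm Bc u) := by
    intro w hw u
    have e : (fun z => s z ^ 2) =ᶠ[nhds w] fun z => eval z (qf Bc) := by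
      filter_upwards [hs.isOpen.mem_nhds hw] with z hz
      rw [hs.sq_eq z hz, aeval_quadPoly]
    have h1 := congrArg (fun L => L u) (e.fderiv_eq (𝕜 := ℂ))
    simp only [fderiv_eval, dirD_qf hBs, map_mul] at h1
    rw [((hsd w hw).hasFDerivAt.pow 2).fderiv] at h1
    refine mul_left_cancel₀ (two_ne_zero (α := ℂ)) ?_
    simpa [mul_assoc] using h1
  induction us with
  | nil => intro w hw; simp [iterDir, maxw]
  | cons u us ih =>
    intro w hw
    have e : iterDir us (fun z => (s z)⁻¹) =ᶠ[nhds w]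
        fun z => eval z (maxw Bc us) * (s z)⁻¹ ^ (2 * us.length + 1) := by
      filter_upwards [hs.isOpen.mem_nhds hw] with z hz
      exact ih z hz
    have h0 := hs.ne_zero w hw
    have hq : eval w (qf Bc) = s w ^ 2 := by rw [hs.sq_eq w hw, aeval_quadPoly]
    have hinv : HasFDerivAt (fun z => (s z)⁻¹) (-(s w ^ 2)⁻¹ • fderiv ℂ s w) w :=
      (hasDerivAt_inv h0).comp_hasFDerivAt w (hsd w hw).hasFDerivAt
    have h1 := (hasFDerivAt_eval (maxw Bc us) w).fun_mul (hinv.pow (2 * us.length + 1))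
    have h2 : iterDir (u :: us) (fun z => (s z)⁻¹) w =
      fderiv ℂ (iterDir us (fun z => (s z)⁻¹)) w u := rfl
    rw [h2, e.fderiv_eq, h1.fderiv, maxw]
    simp only [map_sub, map_mul, hq, eval_C, ← hds w hw u]
    simp [gradAt_apply]
    field_simp
    ring

/-- Split the exponent 2(d-k)+1 as 2k + (2(d-2k)+1): the second part cancels the powers of s from
the derivatives, the first gives Q^k. The result no longer depends on the branch. -/
theorem maxwellSum_eq {B : Matrix (Fin 3) (Fin 3) ℝ} (hB : B.IsSymm) {W : Set (Fin 3 → ℂ)}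
    {s : (Fin 3 → ℂ) → ℂ} (hs : IsSqrtBranch B W s) (d : ℕ)
    (u : (k : ℕ) → Fin (d - 2 * k) → Fin 3 → ℂ) (lam : ℝ) {w : Fin 3 → ℂ} (hw : w ∈ W) :
    maxwellSum d u lam s w = ∑ k ∈ Finset.range (d / 2 + 1),
      eval w (qf (B.map (algebraMap ℝ ℂ)) ^ k * (C (if 2 * k = d then (lam : ℂ) else 1) *
        maxw (B.map (algebraMap ℝ ℂ)) (List.ofFn (u k)))) := by
  refine Finset.sum_congr rfl fun k hk => ?_
  rw [Finset.mem_range] at hk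
  have h0 := hs.ne_zero w hw
  rw [iterDir_inv_eq hB hs _ w hw, map_mul, map_mul, map_pow, eval_C, ← aeval_quadPoly,
    ← hs.sq_eq w hw, List.length_ofFn, ← pow_mul,
    show 2 * (d - k) + 1 = 2 * k + (2 * (d - 2 * k) + 1) by omega, pow_add, inv_pow]
  field_simp

end Derivatives

/-! ### Rational parametrization of the complex cone -/

section Parametrization

open Complex (I)

/-- The point `((1 - t²)/2, -i(1 + t²)/2, t)` of the cone `x₀² + x₁² + x₂² = 0`. -/
noncomputable def conePoint (t : ℂ) : Fin 3 → ℂ :=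
  ![(1 - t ^ 2) / 2, -I * (1 + t ^ 2) / 2, t]

/-- The generic point of the cone. -/
noncomputable def coneVec : Fin 3 → Polynomial ℂ :=
  ![Polynomial.C (1 / 2) * (1 - Polynomial.X ^ 2), Polynomial.C (-I / 2) * (1 + Polynomial.X ^ 2),
    Polynomial.X]

/-- Restriction of a polynomial to the parametrized cone. -/
noncomputable def par : MvPolynomial (Fin 3) ℂ →ₐ[ℂ] Polynomial ℂ := aeval coneVec

theorem eval_coneVec (t : ℂ) (i : Fin 3) : (coneVec i).eval t = conePoint t i := by
  fin_cases i <;> simp [coneVec, conePoint] <;> ring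

theorem eval_par (t : ℂ) (P : MvPolynomial (Fin 3) ℂ) :
    (par P).eval t = eval (conePoint t) P := by
  have h : (Polynomial.evalRingHom t).comp par.toRingHom = eval (conePoint t) := by
    refine ringHom_ext (fun a => ?_) fun i => ?_
    · simp [par]
    · simp [par, eval_coneVec]
  exact RingHom.congr_fun h P

theorem par_qf_one : par (qf 1) = 0 := by
  refine Polynomial.funext fun t => ?_
  rw [eval_par, eval_qf, Matrix.vecMul_one]
  simp [dotProduct, Fin.sum_univ_three, conePoint]
  linear_combination (1 + t ^ 2) ^ 2 / 4 * Complex.I_sq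

theorem eval_smul_of_isHomogeneous {P : MvPolynomial (Fin 3) ℂ} {n : ℕ} (h : P.IsHomogeneous n)
    (z : ℂ) (v : Fin 3 → ℂ) : eval (z • v) P = z ^ n * eval v P := by
  rw [eval_eq, eval_eq, Finset.mul_sum]
  refine Finset.sum_congr rfl fun s hs => ?_
  have hd : ∑ i ∈ s.support, s i = n := by
    simpa [Finsupp.weight_apply, Finsupp.sum] using h (mem_support_iff.1 hs)
  simp only [Pi.smul_apply, smul_eq_mul, mul_pow, Finset.prod_mul_distrib]
  rw [Finset.prod_pow_eq_pow_sum, hd]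
  ring

/-- Every point of the cone with x₀ + i x₁ ≠ 0 is a multiple of some `conePoint`, and such points
suffice for the divisibility criterion. -/
theorem qf_one_dvd_of_par_eq_zero {P : MvPolynomial (Fin 3) ℂ} {n : ℕ} (h : P.IsHomogeneous n)
    (h0 : par P = 0) : qf 1 ∣ P := by
  -- Positive integer coordinates ensure that the solved coordinate y is nonzero and that y + i x₀ ≠
  -- 0.
  have hsum : ∀ x ∈ Set.pi Set.univ fun _ : Fin 2 => Set.range fun n : ℕ => (n + 1 : ℂ),
      x 1 ≠ 0 ∧ x 0 ^ 2 + x 1 ^ 2 ≠ 0 := by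
    intro x hx
    obtain ⟨a, ha⟩ := hx 0 trivial
    obtain ⟨b, hb⟩ := hx 1 trivial
    simp only at ha hb
    rw [← ha, ← hb]
    refine ⟨by exact_mod_cast b.succ_ne_zero, ?_⟩
    exact_mod_cast (by positivity : (a + 1) ^ 2 + (b + 1) ^ 2 ≠ 0)
  have key := qf_diagonal_sub_dvd (d := fun _ => (1 : ℂ)) one_ne_zero 0 (P := P)
    (fun _ => Set.range fun n : ℕ => (n + 1 : ℂ))
    (fun _ => Set.infinite_range_of_injective fun a b hab => by simpa using hab)
    (fun x hx => ?_) (fun x hx y hy => ?_)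
  · rwa [C_0, sub_zero, Matrix.diagonal_one] at key
  · obtain ⟨y, hy⟩ := IsAlgClosed.exists_pow_nat_eq (-(x 0 ^ 2 + x 1 ^ 2)) (n := 2) two_pos
    refine ⟨y, ?_, by rw [hy]; ring⟩
    rintro rfl
    apply (hsum x hx).2
    linear_combination hy
  · set z := y + I * x 0 with hz
    have hz0 : z ≠ 0 := by
      intro hz0
      have h1 : x 1 ^ 2 = 0 := by
        linear_combination hy - (y - I * x 0) * hz0 + (y - I * x 0) * hz - x 0 ^ 2 * Complex.I_sq
      exact (hsum x hx).1 (by simpa using h1)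
    have hpt : (Fin.cons y x : Fin 3 → ℂ) = z • conePoint (x 1 / z) := by
      have h1 : z * (x 1 / z) ^ 2 = -(y - I * x 0) := by
        field_simp
        rw [hz]
        linear_combination hy - x 0 ^ 2 * Complex.I_sq
      funext i
      fin_cases i
      · simp [conePoint]
        linear_combination (-1 / 2 : ℂ) * hz + h1 / 2
      · simp [conePoint]
        linear_combination (I / 2 : ℂ) * hz + I * h1 / 2 + x 0 * Complex.I_sq
      · change x 1 = z * (x 1 / z)
        field_simp
    rw [hpt, eval_smul_of_isHomogeneous h, ← eval_par, h0]
    simp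

theorem natDegree_par_le {P : MvPolynomial (Fin 3) ℂ} {n : ℕ} (h : P.IsHomogeneous n) :
    (par P).natDegree ≤ 2 * n := by
  rw [mul_comm]
  refine aeval_natDegree_le P h.totalDegree_le _ fun i => ?_
  fin_cases i
  · simp only [coneVec]; simp; compute_degree
  · simp only [coneVec]; simp; compute_degree
  · simp [coneVec]

/-- The quadratic polynomial `u · coneVec`. -/
noncomputable def quad : (Fin 3 → ℂ) →ₗ[ℂ] Polynomial ℂ :=
  par.toLinearMap ∘ₗ
    { toFun := linForm 1
      map_add' := fun u v => by simp [linForm, add_mul, Finset.sum_add_distrib]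
      map_smul' := fun a u => by simp [linForm, smul_eq_C_mul, Finset.mul_sum, mul_assoc] }

theorem quad_apply (u : Fin 3 → ℂ) : quad u = par (linForm 1 u) := rfl

theorem eval_quad (u : Fin 3 → ℂ) (t : ℂ) : (quad u).eval t = u ⬝ᵥ conePoint t := by
  rw [quad_apply, eval_par, eval_linForm, Matrix.vecMul_one]

theorem quad_eq (u : Fin 3 → ℂ) : quad u = Polynomial.C ((u 0 - I * u 1) / 2)
    + Polynomial.C (u 2) * Polynomial.X - Polynomial.C ((u 0 + I * u 1) / 2) * Polynomial.X ^ 2 := by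
  refine Polynomial.funext fun t => ?_
  rw [eval_quad]
  simp [dotProduct, Fin.sum_univ_three, conePoint]
  ring

theorem exists_quad_eq {q : Polynomial ℂ} (hq : q.natDegree ≤ 2) : ∃ u, quad u = q := by
  refine ⟨![q.coeff 0 - q.coeff 2, I * (q.coeff 0 + q.coeff 2), q.coeff 1], ?_⟩
  rw [Polynomial.as_sum_range_C_mul_X_pow' q (Nat.lt_succ_of_le hq), quad_eq]
  simp only [Finset.sum_range_succ, Finset.sum_range_zero, pow_zero, pow_one, zero_add, mul_one]
  refine Polynomial.funext fun t => ?_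
  simp
  linear_combination (-(q.coeff 0 + q.coeff 2) / 2 - (q.coeff 0 + q.coeff 2) / 2 * t ^ 2) * Complex.I_sq

/-- Roots may be grouped in pairs arbitrarily, since every polynomial of degree at most 2 is some
`quad u`. Missing degree is filled by linear or constant factors, that is, by roots at infinity. -/
theorem exists_prod_quad (n : ℕ) : ∀ f : Polynomial ℂ, f.natDegree ≤ 2 * n →
    ∃ (c : ℂ) (u : Fin n → Fin 3 → ℂ), f = Polynomial.C c * ∏ j, quad (u j) := by
  have hroot : ∀ f : Polynomial ℂ, 0 < f.natDegree →
      ∃ r g, f = (Polynomial.X - Polynomial.C r) * g ∧ g.natDegree + 1 = f.natDegree := by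
    intro f hf
    obtain ⟨r, hr⟩ := IsAlgClosed.exists_root f (Polynomial.natDegree_pos_iff_degree_pos.1 hf).ne'
    obtain ⟨g, hg⟩ := Polynomial.dvd_iff_isRoot.2 hr
    refine ⟨r, g, hg, ?_⟩
    have hg0 : g ≠ 0 := by rintro rfl; rw [hg, mul_zero] at hf; simp at hf
    rw [hg, Polynomial.natDegree_mul (Polynomial.X_sub_C_ne_zero r) hg0,
      Polynomial.natDegree_X_sub_C, add_comm]
  induction n with
  | zero =>
    intro f hf
    exact ⟨f.coeff 0, Fin.elim0, by simpa using Polynomial.eq_C_of_natDegree_le_zero hf⟩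
  | succ n ih =>
    intro f hf
    obtain ⟨q, g, hfg, hq, hg⟩ : ∃ q g : Polynomial ℂ, f = q * g ∧ q.natDegree ≤ 2 ∧
        g.natDegree ≤ 2 * n := by
      rcases le_or_gt f.natDegree (2 * n) with h | h
      · exact ⟨1, f, by simp, by simp, h⟩
      obtain ⟨r, g, hg, hgd⟩ := hroot f (by omega)
      rcases le_or_gt g.natDegree (2 * n) with h' | h'
      · exact ⟨_, g, hg, by rw [Polynomial.natDegree_X_sub_C]; omega, h'⟩
      obtain ⟨r', g', hg', hgd'⟩ := hroot g (by omega)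
      refine ⟨(Polynomial.X - Polynomial.C r) * (Polynomial.X - Polynomial.C r'), g', ?_, ?_, by omega⟩
      · rw [hg, hg', mul_assoc]
      · refine Polynomial.natDegree_mul_le.trans ?_
        rw [Polynomial.natDegree_X_sub_C, Polynomial.natDegree_X_sub_C]
    obtain ⟨c, u, hu⟩ := ih g hg
    obtain ⟨v, hv⟩ := exists_quad_eq hq
    refine ⟨c, Fin.cons v u, ?_⟩
    rw [Fin.prod_univ_succ, hfg, hu, ← hv]
    simp only [Fin.cons_zero, Fin.cons_succ]
    ring

end Parametrization

/-! ### Real forms, antipodal pairs of roots and unique factorization -/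

section RealStructure

open Complex (I)

/-- The polynomials of "degree `2n`" that are compatible with the antipodal map `t ↦ -1 / conj t`. -/
def Antipodal (n : ℕ) (f : Polynomial ℂ) : Prop :=
  ∀ t : ℂ, t ≠ 0 → f.eval (-(conj t)⁻¹) = (-((conj t)⁻¹) ^ 2) ^ n * conj (f.eval t)

/-- A real vector as a complex one. -/
def toC (u : Fin 3 → ℝ) : Fin 3 → ℂ := fun i => (u i : ℂ)

/-- The antipodal map of the parameter is complex conjugation on the cone, up to scale; this is how
reality of a form becomes visible in t. -/
theorem conePoint_antipode {t : ℂ} (ht : t ≠ 0) :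
    conePoint (-(conj t)⁻¹) = (-((conj t)⁻¹) ^ 2) • fun i => conj (conePoint t i) := by
  have hc : conj t ≠ 0 := by simpa using ht
  funext i
  fin_cases i
  · simp [conePoint, Complex.conj_ofNat]; field_simp; ring
  · simp [conePoint, Complex.conj_ofNat]; field_simp; ring
  · simp [conePoint]; field_simp

theorem eval_map_conj (P : MvPolynomial (Fin 3) ℝ) (w : Fin 3 → ℂ) :
    eval (fun i => conj (w i)) (MvPolynomial.map (algebraMap ℝ ℂ) P) =
      conj (eval w (MvPolynomial.map (algebraMap ℝ ℂ) P)) := by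
  rw [eval_map, eval_map, ← coe_eval₂Hom, ← coe_eval₂Hom, ← RingHom.comp_apply]
  congr 1
  refine ringHom_ext (fun a => ?_) fun i => ?_
  · simp
  · simp

theorem antipodal_par {P : MvPolynomial (Fin 3) ℝ} {n : ℕ} (h : P.IsHomogeneous n) :
    Antipodal n (par (MvPolynomial.map (algebraMap ℝ ℂ) P)) := by
  intro t ht
  rw [eval_par, eval_par, conePoint_antipode ht, eval_smul_of_isHomogeneous (h.map _), eval_map_conj]

theorem antipodal_quad (u : Fin 3 → ℝ) : Antipodal 1 (quad (toC u)) := by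
  intro t ht
  rw [eval_quad, eval_quad, conePoint_antipode ht]
  simp [dotProduct, Fin.sum_univ_three, toC]
  ring

/-- The real vector whose quadratic polynomial has the root `r`. -/
noncomputable def rootVec (r : ℂ) : Fin 3 → ℝ := ![-2 * r.re, 2 * r.im, 1 - (r.re ^ 2 + r.im ^ 2)]

/-- The second root is the antipode of r; for r = 0 it lies at infinity and the second factor is 1.
-/
theorem quad_rootVec (r : ℂ) : quad (toC (rootVec r)) =
    (Polynomial.X - Polynomial.C r) * (Polynomial.C (conj r) * Polynomial.X + 1) := by
  have h1 : (toC (rootVec r) 0 - I * toC (rootVec r) 1) / 2 = -r := by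
    apply Complex.ext <;> simp [toC, rootVec] <;> ring
  have h2 : (toC (rootVec r) 0 + I * toC (rootVec r) 1) / 2 = -conj r := by
    apply Complex.ext <;> simp [toC, rootVec]
    ring
  have h3 : toC (rootVec r) 2 = 1 - r * conj r := by
    rw [Complex.mul_conj]
    simp [toC, rootVec, Complex.normSq_apply]
    ring
  rw [quad_eq, h1, h2, h3]
  simp
  ring

theorem rootVec_dot_pos (r : ℂ) : 0 < rootVec r ⬝ᵥ rootVec r := by
  have : rootVec r ⬝ᵥ rootVec r = (1 + (r.re ^ 2 + r.im ^ 2)) ^ 2 := by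
    simp [dotProduct, Fin.sum_univ_three, rootVec]; ring
  rw [this]; positivity

/-- The real and imaginary parts are two linear equations in three real unknowns, whose solutions
form a line. -/
theorem eq_smul_rootVec {u : Fin 3 → ℝ} {r : ℂ} (h : (quad (toC u)).eval r = 0) :
    ∃ a : ℝ, u = a • rootVec r := by
  rw [eval_quad] at h
  have hre := congrArg Complex.re h
  have him := congrArg Complex.im h
  simp [dotProduct, Fin.sum_univ_three, toC, conePoint, pow_two] at hre him
  set x := r.re
  set y := r.im
  have e1 : u 0 * (1 - (x * x - y * y)) + u 1 * (2 * x * y) + 2 * u 2 * x = 0 := by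
    linear_combination 2 * hre
  have e2 : u 0 * (2 * x * y) + u 1 * (1 + (x * x - y * y)) - 2 * u 2 * y = 0 := by
    linear_combination -2 * him
  have hN : (1 + (x ^ 2 + y ^ 2)) ≠ 0 := by positivity
  -- Up to constants, c1, c2 and c3 are the coordinates of the cross product of u and `rootVec r`;
  -- once they vanish, u equals its projection on `rootVec r`.
  have c1 : u 0 * y + u 1 * x = 0 := by
    refine (mul_eq_zero.1 (?_ : (1 + (x ^ 2 + y ^ 2)) * _ = 0)).resolve_left hN
    linear_combination y * e1 + x * e2
  have c2 : u 0 * (1 - (x ^ 2 + y ^ 2)) + 2 * u 2 * x = 0 := by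
    linear_combination e1 - 2 * y * c1
  have c3 : u 1 * (1 - (x ^ 2 + y ^ 2)) - 2 * u 2 * y = 0 := by
    linear_combination e2 - 2 * x * c1
  have hp := rootVec_dot_pos r
  refine ⟨(u ⬝ᵥ rootVec r) / (rootVec r ⬝ᵥ rootVec r), ?_⟩
  funext i
  rw [Pi.smul_apply, smul_eq_mul, div_mul_eq_mul_div, eq_div_iff hp.ne']
  simp only [dotProduct, Fin.sum_univ_three, rootVec]
  fin_cases i
  · simp
    linear_combination (4 * y) * c1 + (1 - (x ^ 2 + y ^ 2)) * c2
  · simp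
    linear_combination (4 * x) * c1 + (1 - (x ^ 2 + y ^ 2)) * c3
  · simp
    linear_combination (2 * x) * c2 - (2 * y) * c3

theorem quad_toC_ne_zero {u : Fin 3 → ℝ} (hu : u ≠ 0) : quad (toC u) ≠ 0 := by
  intro h
  have h0 := congrArg (Polynomial.eval 0) h
  have h1 := congrArg (Polynomial.eval 1) h
  rw [eval_quad] at h0 h1
  simp [dotProduct, Fin.sum_univ_three, toC, conePoint, Complex.ext_iff] at h0 h1
  apply hu
  funext i
  fin_cases i
  · simpa using h0.1
  · simpa using h0.2
  · simpa using h1.1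

/-- The factor cancels away from its finitely many roots, and continuity extends the identity to
them. -/
theorem Antipodal.congr_of_quad_mul {n : ℕ} {u : Fin 3 → ℝ} (hu : u ≠ 0) {g : Polynomial ℂ}
    (h : Antipodal (n + 1) (quad (toC u) * g)) : Antipodal n g := by
  intro t ht
  set q := quad (toC u)
  have hq := antipodal_quad u
  have hpt : ∀ z : ℂ, z ≠ 0 → q.eval z ≠ 0 →
      g.eval (-(conj z)⁻¹) = (-((conj z)⁻¹) ^ 2) ^ n * conj (g.eval z) := by
    intro z hz hqz
    have h1 := h z hz
    have hz' : (conj z)⁻¹ ≠ 0 := inv_ne_zero (by simpa using hz)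
    rw [Polynomial.eval_mul, Polynomial.eval_mul, map_mul, hq z hz] at h1
    have hne : (-((conj z)⁻¹) ^ 2) * conj (q.eval z) ≠ 0 :=
      mul_ne_zero (neg_ne_zero.2 (pow_ne_zero _ hz')) (by simpa using hqz)
    refine mul_left_cancel₀ hne ?_
    rw [pow_one] at h1
    rw [h1]; ring
  have hF : ContinuousAt (fun z : ℂ => g.eval (-(conj z)⁻¹)) t := by
    refine g.continuous.continuousAt.comp ?_
    exact ((Complex.continuous_conj.continuousAt).inv₀ (by simpa using ht)).neg
  have hG : ContinuousAt (fun z : ℂ => (-((conj z)⁻¹) ^ 2) ^ n * conj (g.eval z)) t := by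
    refine ContinuousAt.mul (ContinuousAt.pow (ContinuousAt.neg (ContinuousAt.pow ?_ 2)) n) ?_
    · exact (Complex.continuous_conj.continuousAt).inv₀ (by simpa using ht)
    · exact (Complex.continuous_conj.comp g.continuous).continuousAt
  have hev : ∀ᶠ z in nhdsWithin t {t}ᶜ,
      g.eval (-(conj z)⁻¹) = (-((conj z)⁻¹) ^ 2) ^ n * conj (g.eval z) := by
    have hfin : ((q.rootSet ℂ ∪ {0}) \ {t}).Finite :=
      ((q.rootSet_finite ℂ).union (Set.finite_singleton 0)).sdiff
    have hmem := hfin.isClosed.isOpen_compl.mem_nhds (x := t) (by simp)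
    filter_upwards [mem_nhdsWithin_of_mem_nhds hmem, self_mem_nhdsWithin] with z hz hzt
    have hz' : z ∉ q.rootSet ℂ ∪ {0} := fun h' => hz ⟨h', hzt⟩
    rw [Set.mem_union, not_or] at hz'
    refine hpt z hz'.2 fun h0 => hz'.1 ?_
    rw [Polynomial.mem_rootSet]
    exact ⟨quad_toC_ne_zero hu, by simpa using h0⟩
  exact tendsto_nhds_unique_of_eventuallyEq (hF.tendsto.mono_left nhdsWithin_le_nhds)
    (hG.tendsto.mono_left nhdsWithin_le_nhds) hev

/-- The values at large t are conjugate to values near 0, so f stays bounded along the positive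
integers and is constant; t = 1 shows that the constant is real. -/
theorem Antipodal.eq_C {f : Polynomial ℂ} (h : Antipodal 0 f) :
    ∃ a : ℝ, f = Polynomial.C (a : ℂ) := by
  have hdeg : f.degree ≤ 0 := by
    by_contra! hd
    have h1 := f.tendsto_norm_atTop hd (z := fun n : ℕ => ((n : ℂ) + 1)) (l := Filter.atTop) (by
      have : (fun n : ℕ => ‖((n : ℂ) + 1)‖) = fun n : ℕ => (n : ℝ) + 1 := by
        funext n
        rw [← Nat.cast_add_one, Complex.norm_natCast]; push_cast; rfl
      rw [this]
      exact Filter.tendsto_atTop_add_const_right _ _ tendsto_natCast_atTop_atTop)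
    have h2 : Filter.Tendsto (fun n : ℕ => ‖f.eval ((n : ℂ) + 1)‖) Filter.atTop
        (nhds ‖f.eval (-0)‖) := by
      have h3 : (fun n : ℕ => ‖f.eval ((n : ℂ) + 1)‖) = fun n : ℕ => ‖f.eval (-(1 / ((n : ℂ) + 1)))‖ := by
        funext n
        have := h ((n : ℂ) + 1) (by exact_mod_cast n.succ_ne_zero)
        simp only [map_add, map_natCast, map_one, pow_zero, one_mul] at this
        rw [one_div, this, Complex.norm_conj]
      rw [h3]
      have h4 : Filter.Tendsto (fun n : ℕ => -(1 / ((n : ℂ) + 1))) Filter.atTop (nhds (-0)) :=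
        (tendsto_one_div_add_atTop_nhds_zero_nat).neg
      exact ((f.continuous.tendsto _).comp h4).norm
    exact not_tendsto_atTop_of_tendsto_nhds h2 h1
  have hC := Polynomial.eq_C_of_degree_le_zero hdeg
  have h1 := h 1 one_ne_zero
  rw [hC] at h1
  simp at h1
  obtain ⟨a, ha⟩ := Complex.conj_eq_iff_real.1 h1.symm
  exact ⟨a, by rw [hC, ha]⟩

/-- A nonzero constant a would satisfy |a| = 4^(-(n+1)) |a|, by the relation at t = 2. -/
theorem Antipodal.exists_root {n : ℕ} {f : Polynomial ℂ} (h : Antipodal (n + 1) f) (hf : f ≠ 0) :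
    ∃ r, f.eval r = 0 := by
  by_cases hd : f.degree = 0
  · exfalso
    have hC := Polynomial.eq_C_of_degree_eq_zero hd
    set a := f.coeff 0
    have ha : a ≠ 0 := by rintro h0; rw [h0, map_zero] at hC; exact hf hC
    have h1 := congrArg norm (h 2 two_ne_zero)
    rw [hC] at h1
    simp at h1
    have h2 : (((2 : ℝ) ^ 2) ^ (n + 1))⁻¹ < 1 := by
      refine inv_lt_one_of_one_lt₀ (one_lt_pow₀ (by norm_num) (by omega))
    have h3 : 0 < ‖a‖ := norm_pos_iff.2 ha
    nlinarith
  · exact IsAlgClosed.exists_root f hd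

/-- A root r brings its antipode with it, so the real quadratic factor of `rootVec r` splits off and
the quotient is again antipodal. -/
theorem Antipodal.exists_prod_quad (n : ℕ) : ∀ f : Polynomial ℂ, Antipodal n f →
    ∃ (c : ℝ) (u : Fin n → Fin 3 → ℝ), f = Polynomial.C (c : ℂ) * ∏ j, quad (toC (u j)) := by
  induction n with
  | zero =>
    intro f hf
    obtain ⟨a, ha⟩ := hf.eq_C
    exact ⟨a, Fin.elim0, by simpa using ha⟩
  | succ n ih =>
    intro f hf
    by_cases h0 : f = 0
    · exact ⟨0, 0, by simp [h0]⟩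
    obtain ⟨r, hr⟩ := hf.exists_root h0
    obtain ⟨g, hg⟩ : quad (toC (rootVec r)) ∣ f := by
      rw [quad_rootVec]
      obtain ⟨g, rfl⟩ := Polynomial.dvd_iff_isRoot.2 hr
      refine mul_dvd_mul_left _ ?_
      by_cases hr0 : r = 0
      · simp [hr0]
      have hc : conj r ≠ 0 := by simpa using hr0
      have h1 := hf r hr0
      -- A root is never its own antipode, as |r|² = -1 is impossible; hence both linear factors
      -- divide f.
      have hne : -(conj r)⁻¹ - r ≠ 0 := by
        intro h
        have h2 : r * conj r = -1 := by
          field_simp at h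
          linear_combination -h
        rw [Complex.mul_conj] at h2
        have h3 : Complex.normSq r = -1 := by exact_mod_cast h2
        linarith [Complex.normSq_nonneg r]
      rw [hr, map_zero, mul_zero, Polynomial.eval_mul] at h1
      have h2 : g.eval (-(conj r)⁻¹) = 0 := (mul_eq_zero.1 h1).resolve_left (by simpa using hne)
      obtain ⟨k, rfl⟩ := Polynomial.dvd_iff_isRoot.2 h2
      refine ⟨Polynomial.C (conj r)⁻¹ * k, ?_⟩
      have h3 : (Polynomial.C (conj r) * Polynomial.C (conj r)⁻¹ : Polynomial ℂ) = 1 := by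
        rw [← map_mul, mul_inv_cancel₀ hc, map_one]
      rw [map_neg]
      linear_combination (-Polynomial.X * k) * h3
    have hne : rootVec r ≠ 0 := fun h => by
      have := rootVec_dot_pos r
      rw [h] at this
      simp at this
    rw [hg] at hf
    obtain ⟨c, u, hu⟩ := ih g (hf.congr_of_quad_mul hne)
    refine ⟨c, Fin.cons (rootVec r) u, ?_⟩
    rw [Fin.prod_univ_succ, hg, hu]
    simp only [Fin.cons_zero, Fin.cons_succ]
    ring

/-- A root of the first factor is a root of some factor on the other side. A real vector is
determined up to scale by one root, so the two vectors are proportional and can be cancelled; c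
collects the ratios. -/
theorem exists_perm_of_prod_quad_eq (n : ℕ) : ∀ (u u' : Fin n → Fin 3 → ℝ) (c : ℝ), c ≠ 0 →
    (∀ j, u j ≠ 0) → (∀ j, u' j ≠ 0) →
    ∏ j, quad (toC (u j)) = Polynomial.C (c : ℂ) * ∏ j, quad (toC (u' j)) →
    ∃ (σ : Equiv.Perm (Fin n)) (t : Fin n → ℝ), ∀ j, u' j = t j • u (σ j) := by
  induction n with
  | zero => exact fun _ _ _ _ _ _ _ => ⟨1, fun _ => 1, fun j => j.elim0⟩
  | succ n ih =>
    intro u u' c hc hu hu' h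
    obtain ⟨r, hr⟩ := (antipodal_quad (u 0)).exists_root (n := 0) (quad_toC_ne_zero (hu 0))
    have h1 := congrArg (Polynomial.eval r) h
    rw [Fin.prod_univ_succ, Polynomial.eval_mul, hr, zero_mul, Polynomial.eval_mul,
      Polynomial.eval_C, Polynomial.eval_prod] at h1
    have h2 := (mul_eq_zero.1 h1.symm).resolve_left (by exact_mod_cast hc)
    obtain ⟨i, -, hi⟩ := Finset.prod_eq_zero_iff.1 h2
    obtain ⟨a, ha⟩ := eq_smul_rootVec hr
    obtain ⟨b, hb⟩ := eq_smul_rootVec hi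
    have ha0 : a ≠ 0 := by rintro rfl; exact hu 0 (by rw [ha, zero_smul])
    have hb0 : b ≠ 0 := by rintro rfl; exact hu' i (by rw [hb, zero_smul])
    have hab : u' i = (b / a) • u 0 := by
      rw [ha, hb, smul_smul, div_mul_cancel₀ _ ha0]
    have hq : quad (toC (u' i)) = Polynomial.C ((b / a : ℝ) : ℂ) * quad (toC (u 0)) := by
      have : toC (u' i) = ((b / a : ℝ) : ℂ) • toC (u 0) := by
        rw [hab]; funext k; simp [toC]
      rw [this, map_smul, Polynomial.smul_eq_C_mul]
    rw [Fin.prod_univ_succ, Fin.prod_univ_succAbove _ i, hq] at h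
    have h3 : ∏ j : Fin n, quad (toC (u j.succ)) =
        Polynomial.C ((c * (b / a) : ℝ) : ℂ) * ∏ j, quad (toC (u' (i.succAbove j))) := by
      refine mul_left_cancel₀ (quad_toC_ne_zero (hu 0)) ?_
      rw [h, Complex.ofReal_mul, map_mul]; ring
    obtain ⟨σ, t, hσ⟩ := ih (fun j => u j.succ) (fun j => u' (i.succAbove j)) _
      (mul_ne_zero hc (div_ne_zero hb0 ha0)) (fun j => hu _) (fun j => hu' _) h3
    -- The permutation sends i to 0 and acts as σ on the remaining indices.
    refine ⟨(finSuccEquiv' i).trans ((Equiv.optionCongr σ).trans (finSuccEquiv' 0).symm),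
      i.insertNth (b / a) t, fun j => ?_⟩
    rcases Fin.eq_self_or_eq_succAbove i j with rfl | ⟨k, rfl⟩
    · simpa using hab
    · simpa using hσ k

theorem prod_quad_smul {n : ℕ} (u : Fin n → Fin 3 → ℝ) (t : Fin n → ℝ) (σ : Equiv.Perm (Fin n)) :
    ∏ j, quad (toC (t j • u (σ j))) =
      Polynomial.C ((∏ j, t j : ℝ) : ℂ) * ∏ j, quad (toC (u j)) := by
  have h : ∀ j, quad (toC (t j • u (σ j))) = Polynomial.C (t j : ℂ) * quad (toC (u (σ j))) := by
    intro j
    have : toC (t j • u (σ j)) = (t j : ℂ) • toC (u (σ j)) := by funext k; simp [toC]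
    rw [this, map_smul, Polynomial.smul_eq_C_mul]
  simp only [h, Finset.prod_mul_distrib, Complex.ofReal_prod, map_prod]
  rw [Equiv.prod_comp σ fun j => quad (toC (u j))]

theorem sameMultipole_of_prod_quad_eq {n : ℕ} (u u' : Fin n → Fin 3 → ℝ)
    (h : ∏ j, quad (toC (u j)) = ∏ j, quad (toC (u' j))) : SameMultipole u u' := by
  by_cases h0 : ∏ j, quad (toC (u j)) = 0
  · left
    have key : ∀ w : Fin n → Fin 3 → ℝ, ∏ j, quad (toC (w j)) = 0 → ∃ j, w j = 0 := by
      intro w hw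
      obtain ⟨j, -, hj⟩ := Finset.prod_eq_zero_iff.1 hw
      exact ⟨j, by_contra fun h' => quad_toC_ne_zero h' hj⟩
    exact ⟨key u h0, key u' (h ▸ h0)⟩
  · right
    have key : ∀ w : Fin n → Fin 3 → ℝ, ∏ j, quad (toC (w j)) ≠ 0 → ∀ j, w j ≠ 0 := by
      intro w hw j hj
      apply hw
      refine Finset.prod_eq_zero (Finset.mem_univ j) ?_
      rw [hj, show toC 0 = 0 by funext i; simp [toC], map_zero]
    obtain ⟨σ, t, ht⟩ := exists_perm_of_prod_quad_eq n u u' 1 one_ne_zero (key u h0)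
      (key u' (h ▸ h0)) (by simpa using h)
    refine ⟨σ, t, ?_, ht⟩
    have h1 := prod_quad_smul u t σ
    simp only [← ht] at h1
    rw [← h] at h1
    have h2 : (Polynomial.C ((∏ j, t j : ℝ) : ℂ) : Polynomial ℂ) = 1 := by
      refine mul_right_cancel₀ h0 ?_
      rw [one_mul, ← h1]
    rw [← map_one Polynomial.C] at h2
    exact_mod_cast Polynomial.C_injective h2

end RealStructure

/-! ### Passage from real to complex coefficients -/

section BaseChange

theorem map_inv_algebraMap {B : Matrix (Fin 3) (Fin 3) ℝ} (hdet : B.det ≠ 0) :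
    (B.map (algebraMap ℝ ℂ))⁻¹ = B⁻¹.map (algebraMap ℝ ℂ) := by
  refine Matrix.inv_eq_right_inv ?_
  rw [← Matrix.map_mul, Matrix.mul_nonsing_inv _ (isUnit_iff_ne_zero.2 hdet),
    Matrix.map_one _ (map_zero _) (map_one _)]

theorem det_map_ne_zero {B : Matrix (Fin 3) (Fin 3) ℝ} (hdet : B.det ≠ 0) :
    (B.map (algebraMap ℝ ℂ)).det ≠ 0 := by
  have := RingHom.map_det (algebraMap ℝ ℂ) B
  rw [RingHom.mapMatrix_apply] at this
  rw [← this]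
  simpa using hdet

theorem map_lap {B : Matrix (Fin 3) (Fin 3) ℝ} (hdet : B.det ≠ 0) (P : MvPolynomial (Fin 3) ℝ) :
    MvPolynomial.map (algebraMap ℝ ℂ) (lap B P) =
      lap (B.map (algebraMap ℝ ℂ)) (MvPolynomial.map (algebraMap ℝ ℂ) P) := by
  simp only [lap_apply, map_sum, map_mul, map_C, pderiv_map, map_inv_algebraMap hdet,
    Matrix.map_apply]

theorem IsHarm.map {B : Matrix (Fin 3) (Fin 3) ℝ} (hdet : B.det ≠ 0) {n : ℕ}
    {P : MvPolynomial (Fin 3) ℝ} (h : IsHarm B n P) :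
    IsHarm (B.map (algebraMap ℝ ℂ)) n (MvPolynomial.map (algebraMap ℝ ℂ) P) :=
  ⟨h.hom.map _, by rw [← map_lap hdet, h.lap_eq, map_zero]⟩

theorem map_linForm (B : Matrix (Fin 3) (Fin 3) ℝ) (u : Fin 3 → ℝ) :
    MvPolynomial.map (algebraMap ℝ ℂ) (linForm B u) =
      linForm (B.map (algebraMap ℝ ℂ)) (toC u) := by
  simp [linForm, Matrix.vecMul, dotProduct, toC]

theorem map_dirD (u : Fin 3 → ℝ) (P : MvPolynomial (Fin 3) ℝ) :
    MvPolynomial.map (algebraMap ℝ ℂ) (dirD u P) =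
      dirD (toC u) (MvPolynomial.map (algebraMap ℝ ℂ) P) := by
  simp [dirD_apply, pderiv_map, toC]

theorem map_maxw (B : Matrix (Fin 3) (Fin 3) ℝ) (us : List (Fin 3 → ℝ)) :
    MvPolynomial.map (algebraMap ℝ ℂ) (maxw B us) =
      maxw (B.map (algebraMap ℝ ℂ)) (us.map toC) := by
  induction us with
  | nil => simp [maxw]
  | cons u us ih => simp [maxw, ih, map_qf, map_linForm, map_dirD]

theorem eval_toC_map (v : Fin 3 → ℝ) (P : MvPolynomial (Fin 3) ℝ) :
    eval (toC v) (MvPolynomial.map (algebraMap ℝ ℂ) P) = ((eval v P : ℝ) : ℂ) := by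
  rw [eval_map, show toC v = fun i => algebraMap ℝ ℂ (v i) from rfl]
  exact (eval₂_comp_left (algebraMap ℝ ℂ) (RingHom.id ℝ) v P).symm ▸ rfl

theorem toC_vecMul (w : Fin 3 → ℝ) (E : Matrix (Fin 3) (Fin 3) ℝ) :
    toC w ᵥ* E.map (algebraMap ℝ ℂ) = toC (w ᵥ* E) := by
  funext i
  simp [toC, Matrix.vecMul, dotProduct]

end BaseChange

/-! ### Harmonic forms as Maxwell polynomials over ℂ -/

section Multipoles

variable {B E : Matrix (Fin 3) (Fin 3) ℂ}

theorem det_ne_zero_of_normal (hE : E * B * Eᵀ = 1) : E.det ≠ 0 := by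
  intro h
  have := congrArg Matrix.det hE
  rw [Matrix.det_mul, Matrix.det_mul, h, zero_mul, zero_mul, Matrix.det_one] at this
  exact zero_ne_one this

theorem subst_linForm (hE : E * B * Eᵀ = 1) (u : Fin 3 → ℂ) :
    subst E (linForm B u) = linForm 1 (u ᵥ* E⁻¹) := by
  have h : E⁻¹ = B * Eᵀ := Matrix.inv_eq_right_inv (by rw [← Matrix.mul_assoc, hE])
  refine MvPolynomial.funext fun v => ?_
  rw [eval_subst, eval_linForm, eval_linForm, Matrix.vecMul_one, h, ← Matrix.vecMul_vecMul,
    ← Matrix.mulVec_transpose E v, Matrix.dotProduct_mulVec]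

theorem par_subst_maxw (hE : E * B * Eᵀ = 1) {n : ℕ} (u : Fin n → Fin 3 → ℂ) :
    par (subst E (maxw B (List.ofFn u))) =
      Polynomial.C (maxwCoeff ℂ n) * ∏ j, quad (u j ᵥ* E⁻¹) := by
  obtain ⟨R, hR⟩ := qf_dvd_maxw_sub B (List.ofFn u)
  rw [sub_eq_iff_eq_add] at hR
  have hC : ∀ a : ℂ, par (subst E (C a)) = Polynomial.C a := fun a => by simp [par, subst]
  rw [hR, map_add, map_add, map_mul, map_mul, subst_qf, hE, par_qf_one, zero_mul, zero_add, map_mul,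
    map_mul, hC, List.length_ofFn, List.map_ofFn, List.prod_ofFn, map_prod, map_prod]
  simp only [Function.comp_apply, subst_linForm hE, quad_apply]

/-- Equality on the normalized cone means congruence modulo Q, which determines a harmonic form. -/
theorem IsHarm.eq_of_par_eq (hB : B.IsSymm) (hdet : B.det ≠ 0) (hE : E * B * Eᵀ = 1) {n : ℕ}
    {P R : MvPolynomial (Fin 3) ℂ} (hP : IsHarm B n P) (hR : IsHarm B n R)
    (h : par (subst E P) = par (subst E R)) : P = R := by
  refine hP.eq_of_dvd_sub hB hdet hR (dvd_of_subst_dvd (det_ne_zero_of_normal hE) ?_)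
  rw [subst_qf, hE]
  exact qf_one_dvd_of_par_eq_zero (isHomogeneous_subst E (hP.hom.sub hR.hom))
    (by rw [map_sub, map_sub, h, sub_self])

theorem C_mul_prod_quad {n : ℕ} (c : ℂ) (u : Fin (n + 1) → Fin 3 → ℂ) :
    ∏ j, quad ((Fin.cons (c • u 0) (fun j => u j.succ) : Fin (n + 1) → Fin 3 → ℂ) j) =
      Polynomial.C c * ∏ j, quad (u j) := by
  rw [Fin.prod_univ_succ, Fin.prod_univ_succ]
  simp only [Fin.cons_zero, Fin.cons_succ]
  rw [map_smul, Polynomial.smul_eq_C_mul, mul_assoc]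

theorem IsHarm.exists_eq_maxw (hB : B.IsSymm) (hdet : B.det ≠ 0) (hE : E * B * Eᵀ = 1) {n : ℕ}
    {H : MvPolynomial (Fin 3) ℂ} (h : IsHarm B (n + 1) H) :
    ∃ u : Fin (n + 1) → Fin 3 → ℂ, H = maxw B (List.ofFn u) := by
  obtain ⟨c, w, hw⟩ := exists_prod_quad (n + 1) _ (natDegree_par_le (isHomogeneous_subst E h.hom))
  have hκ := maxwCoeff_ne_zero (K := ℂ) (n + 1)
  -- The first vector absorbs c and `maxwCoeff`; this needs at least one vector, hence degree n + 1.
  set w' : Fin (n + 1) → Fin 3 → ℂ := Fin.cons ((c / maxwCoeff ℂ (n + 1)) • w 0) fun j => w j.succ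
  refine ⟨fun j => w' j ᵥ* E, h.eq_of_par_eq hB hdet hE ?_ ?_⟩
  · simpa using isHarm_maxw hB hdet (List.ofFn fun j => w' j ᵥ* E)
  · rw [par_subst_maxw hE, hw]
    simp only [Matrix.vecMul_vecMul,
      Matrix.mul_nonsing_inv _ (isUnit_iff_ne_zero.2 (det_ne_zero_of_normal hE)), Matrix.vecMul_one]
    rw [C_mul_prod_quad, ← mul_assoc, ← map_mul, mul_div_cancel₀ _ hκ]

theorem exists_normalization {B : Matrix (Fin 3) (Fin 3) ℝ} (hB : B.IsSymm) (hdet : B.det ≠ 0) :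
    ∃ E : Matrix (Fin 3) (Fin 3) ℂ, E * B.map (algebraMap ℝ ℂ) * Eᵀ = 1 := by
  obtain ⟨U, d, hU, hd⟩ := exists_diagonalization hB
  choose s hs using fun i => IsAlgClosed.exists_pow_nat_eq ((d i : ℂ)) (n := 2) two_pos
  have hd0 := diagonal_ne_zero hU hdet hd
  have hs0 : ∀ i, s i ≠ 0 := fun i h0 => hd0 i (by
    have := hs i
    rw [h0, zero_pow two_ne_zero] at this
    exact_mod_cast this.symm)
  refine ⟨Matrix.diagonal (fun i => (s i)⁻¹) * U.map (algebraMap ℝ ℂ), ?_⟩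
  have h1 : U.map (algebraMap ℝ ℂ) * B.map (algebraMap ℝ ℂ) * (U.map (algebraMap ℝ ℂ))ᵀ =
      Matrix.diagonal fun i => (d i : ℂ) := by
    rw [← Matrix.map_mul, ← Matrix.transpose_map, ← Matrix.map_mul, hd,
      Matrix.diagonal_map (map_zero _)]
    rfl
  rw [Matrix.transpose_mul, Matrix.diagonal_transpose]
  calc _ = Matrix.diagonal (fun i => (s i)⁻¹) * (U.map (algebraMap ℝ ℂ) * B.map (algebraMap ℝ ℂ)
        * (U.map (algebraMap ℝ ℂ))ᵀ) * Matrix.diagonal (fun i => (s i)⁻¹) := by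
        simp only [Matrix.mul_assoc]
    _ = 1 := by
        rw [h1, Matrix.diagonal_mul_diagonal, Matrix.diagonal_mul_diagonal, ← Matrix.diagonal_one]
        congr 1
        funext i
        have := hs0 i
        rw [← hs i]; field_simp

theorem exists_real_normalization {B : Matrix (Fin 3) (Fin 3) ℝ} (hB : B.PosDef) :
    ∃ E : Matrix (Fin 3) (Fin 3) ℝ, E * B * Eᵀ = 1 := by
  have hs : B.IsSymm := by
    have := hB.isHermitian
    rwa [Matrix.IsHermitian, Matrix.conjTranspose_eq_transpose_of_trivial] at this
  obtain ⟨U, d, hU, hd⟩ := exists_diagonalization hs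
  have hpos : ∀ i, 0 < d i := fun i => by
    have h1 : (U * B * Uᵀ).PosDef := by
      have := hB.mul_mul_conjTranspose_same (B := U) (Matrix.vecMul_injective_of_isUnit
        ((Matrix.isUnit_iff_isUnit_det U).2 (isUnit_iff_ne_zero.2 hU)))
      rwa [Matrix.conjTranspose_eq_transpose_of_trivial] at this
    rw [hd] at h1
    simpa using h1.diag_pos (i := i)
  refine ⟨Matrix.diagonal (fun i => (Real.sqrt (d i))⁻¹) * U, ?_⟩
  rw [Matrix.transpose_mul, Matrix.diagonal_transpose]
  calc _ = Matrix.diagonal (fun i => (Real.sqrt (d i))⁻¹) * (U * B * Uᵀ) *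
        Matrix.diagonal (fun i => (Real.sqrt (d i))⁻¹) := by
        simp only [Matrix.mul_assoc]
    _ = 1 := by
        rw [hd, Matrix.diagonal_mul_diagonal, Matrix.diagonal_mul_diagonal, ← Matrix.diagonal_one]
        congr 1
        funext i
        have h1 := Real.sqrt_pos.2 (hpos i)
        have h2 := Real.mul_self_sqrt (hpos i).le
        field_simp
        linear_combination -h2

end Multipoles

/-! ### The positive definite case: existence and uniqueness of real vectors -/

section RealMultipoles

variable {B E : Matrix (Fin 3) (Fin 3) ℝ}

theorem normal_map (hE : E * B * Eᵀ = 1) :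
    E.map (algebraMap ℝ ℂ) * B.map (algebraMap ℝ ℂ) * (E.map (algebraMap ℝ ℂ))ᵀ = 1 := by
  rw [← Matrix.map_mul, ← Matrix.transpose_map, ← Matrix.map_mul, hE,
    Matrix.map_one _ (map_zero _) (map_one _)]

theorem map_subst (U : Matrix (Fin 3) (Fin 3) ℝ) (P : MvPolynomial (Fin 3) ℝ) :
    MvPolynomial.map (algebraMap ℝ ℂ) (subst U P) =
      subst (U.map (algebraMap ℝ ℂ)) (MvPolynomial.map (algebraMap ℝ ℂ) P) := by
  induction P using MvPolynomial.induction_on with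
  | C a => simp [subst]
  | add p q hp hq => simp only [map_add, hp, hq]
  | mul_X p k hp =>
    simp only [map_mul, hp]
    simp [subst]

theorem IsHarm.exists_eq_maxw_real (hB : B.IsSymm) (hdet : B.det ≠ 0) (hE : E * B * Eᵀ = 1) {n : ℕ}
    {H : MvPolynomial (Fin 3) ℝ} (h : IsHarm B (n + 1) H) :
    ∃ u : Fin (n + 1) → Fin 3 → ℝ, MvPolynomial.map (algebraMap ℝ ℂ) H =
      maxw (B.map (algebraMap ℝ ℂ)) (List.ofFn fun j => toC (u j)) := by
  have hE' := normal_map hE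
  have hanti := antipodal_par (isHomogeneous_subst E h.hom)
  rw [map_subst] at hanti
  obtain ⟨c, w, hw⟩ := hanti.exists_prod_quad
  have hκ := maxwCoeff_ne_zero (K := ℝ) (n + 1)
  have hκc : maxwCoeff ℂ (n + 1) = ((maxwCoeff ℝ (n + 1) : ℝ) : ℂ) := by
    simp [maxwCoeff]
  set a : ℝ := c / maxwCoeff ℝ (n + 1) with ha
  set w' : Fin (n + 1) → Fin 3 → ℝ := Fin.cons (a • w 0) fun j => w j.succ with hw'
  have hBs : (B.map (algebraMap ℝ ℂ)).IsSymm := hB.map _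
  have hBd := det_map_ne_zero hdet
  refine ⟨fun j => w' j ᵥ* E, (h.map hdet).eq_of_par_eq hBs hBd hE' ?_ ?_⟩
  · simpa using isHarm_maxw hBs hBd (List.ofFn fun j => toC (w' j ᵥ* E))
  · have hww : ∀ j, toC (w' j) =
        (Fin.cons ((a : ℂ) • toC (w 0)) fun j => toC (w j.succ) : Fin (n + 1) → Fin 3 → ℂ) j := by
      intro j
      refine Fin.cases ?_ (fun j => ?_) j
      · funext i; simp [hw', toC]
      · simp [hw']
    rw [par_subst_maxw hE', hw]
    simp only [← toC_vecMul, Matrix.vecMul_vecMul,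
      Matrix.mul_nonsing_inv _ (isUnit_iff_ne_zero.2 (det_ne_zero_of_normal hE')),
      Matrix.vecMul_one, hww]
    rw [C_mul_prod_quad (a : ℂ) fun j => toC (w j), ← mul_assoc, ← map_mul, hκc,
      ← Complex.ofReal_mul, ha, mul_div_cancel₀ _ hκ]

theorem sameMultipole_of_maxw_eq (hE : E * B * Eᵀ = 1) {n : ℕ}
    (u u' : Fin n → Fin 3 → ℝ) (h : maxw B (List.ofFn u) = maxw B (List.ofFn u')) :
    SameMultipole u u' := by
  have hE' := normal_map hE
  have hdE : E.det ≠ 0 := by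
    intro h
    have := congrArg Matrix.det hE
    rw [Matrix.det_mul, Matrix.det_mul, h, zero_mul, zero_mul, Matrix.det_one] at this
    exact zero_ne_one this
  have h1 := congrArg (fun P => par (subst (E.map (algebraMap ℝ ℂ))
    (MvPolynomial.map (algebraMap ℝ ℂ) P))) h
  simp only [map_maxw, List.map_ofFn, par_subst_maxw hE', Function.comp_apply,
    map_inv_algebraMap hdE, toC_vecMul] at h1
  have h2 := sameMultipole_of_prod_quad_eq _ _ (mul_left_cancel₀
    (by simpa using maxwCoeff_ne_zero (K := ℂ) n) h1)
  have hinj : Function.Injective fun w : Fin 3 → ℝ => w ᵥ* E⁻¹ := fun a b hab => by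
    have := congrArg (· ᵥ* E) hab
    simpa [Matrix.vecMul_vecMul, Matrix.nonsing_inv_mul _ (isUnit_iff_ne_zero.2 hdE)] using this
  rcases h2 with ⟨⟨j, hj⟩, ⟨j', hj'⟩⟩ | ⟨σ, t, ht, hσ⟩
  · exact Or.inl ⟨⟨j, hinj (by simpa using hj)⟩, ⟨j', hinj (by simpa using hj')⟩⟩
  · exact Or.inr ⟨σ, t, ht, fun j => hinj (by simpa [Matrix.smul_vecMul] using hσ j)⟩

end RealMultipoles

/-! ### From the harmonic decomposition to the full representation -/

section Representation

variable {B : Matrix (Fin 3) (Fin 3) ℝ}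

/-- The map f covers complex vectors (identity) and real vectors (`toC`) at once. The sum equals P
itself, so taking real parts loses nothing. -/
theorem exists_maxwellRep (hB : B.IsSymm) (hdet : B.det ≠ 0) {α : Type*} [Inhabited α]
    (f : α → Fin 3 → ℂ)
    (hf : ∀ n H, IsHarm B (n + 1) H → ∃ u : Fin (n + 1) → α,
      MvPolynomial.map (algebraMap ℝ ℂ) H =
        maxw (B.map (algebraMap ℝ ℂ)) (List.ofFn fun j => f (u j)))
    {d : ℕ} {P : MvPolynomial (Fin 3) ℝ} (hP : P.IsHomogeneous d) :
    ∃ (u : (k : ℕ) → Fin (d - 2 * k) → α) (lam : ℝ),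
      MaxwellRep B d P (fun k j => f (u k j)) lam := by
  obtain ⟨h, hh, hsum⟩ := mem_span_qf_pow_mul hB hdet d P hP
  have hex : ∀ k, ∃ u : Fin (d - 2 * k) → α, 2 * k < d →
      MvPolynomial.map (algebraMap ℝ ℂ) (h k) =
        maxw (B.map (algebraMap ℝ ℂ)) (List.ofFn fun j => f (u j)) := by
    intro k
    rcases lt_or_ge (2 * k) d with hk | hk
    · obtain ⟨n, hn⟩ : ∃ n, d - 2 * k = n + 1 := ⟨d - 2 * k - 1, by omega⟩
      have := hh k hk.le
      rw [hn] at this ⊢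
      obtain ⟨u, hu⟩ := hf n _ this
      exact ⟨u, fun _ => hu⟩
    · exact ⟨fun _ => default, fun h' => absurd h' (by omega)⟩
  choose u hu using hex
  -- For even d the last harmonic component is a constant, and this is λ; for odd d the value plays
  -- no role.
  refine ⟨u, coeff 0 (h (d / 2)), fun W s hs v hv => ?_⟩
  rw [maxwellSum_eq hB hs d _ _ hv]
  have h1 : MvPolynomial.map (algebraMap ℝ ℂ) P = ∑ k ∈ Finset.range (d / 2 + 1),
      (qf (B.map (algebraMap ℝ ℂ)) ^ k *
        (C (if 2 * k = d then ((coeff 0 (h (d / 2)) : ℝ) : ℂ) else 1) *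
        maxw (B.map (algebraMap ℝ ℂ)) (List.ofFn fun j => f (u k j)))) := by
    rw [hsum, map_sum]
    refine Finset.sum_congr rfl fun k hk => ?_
    rw [Finset.mem_range] at hk
    rw [map_mul, map_pow, map_qf]
    congr 1
    split_ifs with h2
    · have h3 := (hh k h2.le).hom
      rw [show d - 2 * k = 0 by omega, ← totalDegree_zero_iff_isHomogeneous,
        totalDegree_eq_zero_iff_eq_C] at h3
      have h4 : ∀ us : List (Fin 3 → ℂ), us.length = 0 →
          maxw (B.map (algebraMap ℝ ℂ)) us = 1 := fun us hus => by
        rw [List.length_eq_zero_iff.1 hus, maxw]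
      rw [h4 _ (by rw [List.length_ofFn]; omega), mul_one, show d / 2 = k by omega]
      conv_lhs => rw [h3]
      simp
    · rw [hu k (by omega), C_1, one_mul]
  rw [← map_sum, ← h1, show (fun i => (v i : ℂ)) = toC v from rfl, eval_toC_map, Complex.ofReal_re]

theorem eq_sum_of_maxwellRep (hB : B.IsSymm) (hdet : B.det ≠ 0) {d : ℕ}
    {P : MvPolynomial (Fin 3) ℝ} {u : (k : ℕ) → Fin (d - 2 * k) → Fin 3 → ℝ} {lam : ℝ}
    (h : MaxwellRep B d P (fun k j i => (u k j i : ℂ)) lam) :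
    P = ∑ k ∈ Finset.range (d / 2 + 1),
      qf B ^ k * (C (if 2 * k = d then lam else 1) * maxw B (List.ofFn (u k))) := by
  -- The representation says nothing on the cone; after multiplication by Q both sides agree there
  -- too.
  refine mul_right_cancel₀ (qf_ne_zero hB hdet) (MvPolynomial.funext fun v => ?_)
  rw [map_mul, map_mul]
  by_cases hv : eval v (qf B) = 0
  · rw [hv, mul_zero, mul_zero]
  congr 1
  have hvc : aeval (toC v) (quadPoly B) ≠ 0 := by
    rw [aeval_quadPoly, ← map_qf, eval_toC_map]
    exact_mod_cast hv
  obtain ⟨W, s, hW, hs⟩ := exists_isSqrtBranch B _ hvc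
  rw [h W s hs v hW, show (fun i => (v i : ℂ)) = toC v from rfl, maxwellSum_eq hB hs d _ _ hW,
    ← map_sum, ← Complex.ofReal_re (eval v _), ← eval_toC_map]
  congr 2
  simp only [map_sum, map_mul, map_pow, map_qf, map_maxw, List.map_ofFn, map_C]
  refine Finset.sum_congr rfl fun k _ => ?_
  congr 2
  split_ifs <;> simp

theorem maxwellRep_unique (hB : B.IsSymm) (hdet : B.det ≠ 0) {E : Matrix (Fin 3) (Fin 3) ℝ}
    (hE : E * B * Eᵀ = 1) {d : ℕ} {P : MvPolynomial (Fin 3) ℝ}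
    {u u' : (k : ℕ) → Fin (d - 2 * k) → Fin 3 → ℝ} {lam lam' : ℝ}
    (h : MaxwellRep B d P (fun k j i => (u k j i : ℂ)) lam)
    (h' : MaxwellRep B d P (fun k j i => (u' k j i : ℂ)) lam') :
    (∀ k : ℕ, 2 * k < d → SameMultipole (u k) (u' k)) ∧ (Even d → lam = lam') := by
  have hharm : ∀ (w : (k : ℕ) → Fin (d - 2 * k) → Fin 3 → ℝ) (μ : ℝ) (k : ℕ),
      IsHarm B (d - 2 * k) (C (if 2 * k = d then μ else 1) * maxw B (List.ofFn (w k))) := by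
    intro w μ k
    have h1 := isHarm_maxw hB hdet (List.ofFn (w k))
    rw [List.length_ofFn] at h1
    refine ⟨?_, by rw [← smul_eq_C_mul, map_smul, h1.lap_eq, smul_zero]⟩
    have := (isHomogeneous_C (Fin 3) (if 2 * k = d then μ else 1)).mul h1.hom
    rwa [zero_add] at this
  have key := harm_unique hB hdet d _ _ (fun k _ => hharm u lam k) (fun k _ => hharm u' lam' k)
    ((eq_sum_of_maxwellRep hB hdet h).symm.trans (eq_sum_of_maxwellRep hB hdet h'))
  refine ⟨fun k hk => ?_, fun hd => ?_⟩
  · have h1 := key k hk.le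
    simp only [if_neg hk.ne, C_1, one_mul] at h1
    exact sameMultipole_of_maxw_eq hE _ _ h1
  · obtain ⟨k, rfl⟩ := hd
    have h1 := key k (by omega)
    have h4 : ∀ us : List (Fin 3 → ℝ), us.length = 0 → maxw B us = 1 := fun us hus => by
      rw [List.length_eq_zero_iff.1 hus, maxw]
    rw [h4 _ (by rw [List.length_ofFn]; omega), h4 _ (by rw [List.length_ofFn]; omega)] at h1
    simpa [two_mul] using h1

end Representation

/-! ### Gaussian integrals and orthogonality on the sphere -/

section Gaussian

/-- The inclusion of the Euclidean space into `ℂ³`. -/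
noncomputable def coeE : EuclideanSpace ℝ (Fin 3) →L[ℝ] (Fin 3 → ℂ) :=
  ContinuousLinearMap.pi fun i => Complex.ofRealCLM ∘L EuclideanSpace.proj i

theorem coeE_apply (x : EuclideanSpace ℝ (Fin 3)) (i : Fin 3) : coeE x i = ((x i : ℝ) : ℂ) := rfl

/-- The Gaussian weight. -/
noncomputable def gauss (x : EuclideanSpace ℝ (Fin 3)) : ℂ := ((Real.exp (-‖x‖ ^ 2 / 2) : ℝ) : ℂ)

theorem continuous_eval_coeE (P : MvPolynomial (Fin 3) ℂ) :
    Continuous fun x : EuclideanSpace ℝ (Fin 3) => eval (coeE x) P :=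
  (MvPolynomial.continuous_eval P).comp coeE.continuous

theorem continuous_gauss : Continuous gauss := by
  unfold gauss; fun_prop

theorem integrable_norm_pow_mul_gauss (n : ℕ) :
    Integrable fun x : EuclideanSpace ℝ (Fin 3) => ‖x‖ ^ n * Real.exp (-‖x‖ ^ 2 / 2) := by
  rw [integrable_fun_norm_addHaar volume (f := fun r : ℝ => r ^ n * Real.exp (-r ^ 2 / 2))]
  have h := integrableOn_rpow_mul_exp_neg_mul_sq (b := 1 / 2) (by norm_num)
    (s := ((n + 2 : ℕ) : ℝ)) (by linarith [(Nat.cast_nonneg (n + 2) : (0 : ℝ) ≤ _)])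
  refine h.congr_fun (fun r hr => ?_) measurableSet_Ioi
  simp only [finrank_euclideanSpace, Fintype.card_fin, smul_eq_mul, Real.rpow_natCast]
  rw [pow_add, show -r ^ 2 / 2 = -(1 / 2) * r ^ 2 by ring]
  ring

theorem integrable_eval_mul_gauss (P : MvPolynomial (Fin 3) ℂ) :
    Integrable fun x : EuclideanSpace ℝ (Fin 3) => eval (coeE x) P * gauss x := by
  induction P using MvPolynomial.induction_on' with
  | monomial s a =>
    refine ((integrable_norm_pow_mul_gauss (∑ i, s i)).const_mul ‖a‖).mono'
      ((continuous_eval_coeE _).mul continuous_gauss).aestronglyMeasurable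
      (Filter.Eventually.of_forall fun x => ?_)
    rw [norm_mul, eval_monomial, norm_mul, mul_assoc]
    refine mul_le_mul_of_nonneg_left ?_ (norm_nonneg _)
    rw [gauss, Complex.norm_real, Real.norm_of_nonneg (Real.exp_pos _).le]
    refine mul_le_mul_of_nonneg_right ?_ (Real.exp_pos _).le
    rw [Finsupp.prod_fintype _ _ (by simp), norm_prod, ← Finset.prod_pow_eq_pow_sum]
    refine Finset.prod_le_prod (fun i _ => norm_nonneg _) fun i _ => ?_
    rw [norm_pow, coeE_apply, Complex.norm_real]
    exact pow_le_pow_left₀ (norm_nonneg _) (PiLp.norm_apply_le x i) _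
  | add p q hp hq =>
    simp only [map_add, add_mul]
    exact hp.add hq

/-- The Gaussian integral of a polynomial. -/
noncomputable def gaussInt : MvPolynomial (Fin 3) ℂ →ₗ[ℂ] ℂ where
  toFun P := ∫ x, eval (coeE x) P * gauss x
  map_add' P R := by
    simp only [map_add, add_mul]
    exact integral_add (integrable_eval_mul_gauss P) (integrable_eval_mul_gauss R)
  map_smul' a P := by
    simp only [smul_eval, mul_assoc, RingHom.id_apply, smul_eq_mul]
    exact integral_const_mul a _

theorem gaussInt_apply (P : MvPolynomial (Fin 3) ℂ) :
    gaussInt P = ∫ x, eval (coeE x) P * gauss x := rfl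

theorem hasFDerivAt_gauss (x : EuclideanSpace ℝ (Fin 3)) :
    HasFDerivAt gauss (-gauss x • (Complex.ofRealCLM ∘L innerSL ℝ x)) x := by
  have h1 : HasFDerivAt (fun y : EuclideanSpace ℝ (Fin 3) => -‖y‖ ^ 2 / 2) (-(innerSL ℝ x)) x := by
    have := ((hasStrictFDerivAt_norm_sq x).hasFDerivAt.neg).const_mul (1 / 2 : ℝ)
    refine (this.congr_fderiv ?_).congr_of_eventuallyEq (Filter.Eventually.of_forall fun y => ?_)
    · ext y; simp
    · simp; ring
  have h2 := Complex.ofRealCLM.hasFDerivAt.comp x h1.exp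
  refine h2.congr_fderiv ?_
  ext y
  simp [gauss]

theorem hasFDerivAt_eval_coeE (P : MvPolynomial (Fin 3) ℂ) (x : EuclideanSpace ℝ (Fin 3)) :
    HasFDerivAt (fun x : EuclideanSpace ℝ (Fin 3) => eval (coeE x) P)
      ((gradAt P (coeE x)).restrictScalars ℝ ∘L coeE) x :=
  ((hasFDerivAt_eval P (coeE x)).restrictScalars ℝ).comp x coeE.hasFDerivAt

/-- Integration by parts, as the i-th derivative of the Gaussian is -x_i times the Gaussian. -/
theorem gaussInt_pderiv (i : Fin 3) (P : MvPolynomial (Fin 3) ℂ) :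
    gaussInt (pderiv i P) = gaussInt (X i * P) := by
  set e : EuclideanSpace ℝ (Fin 3) := EuclideanSpace.single i 1 with he
  have h1 : ∀ x, fderiv ℝ (fun x : EuclideanSpace ℝ (Fin 3) => eval (coeE x) P) x e =
      eval (coeE x) (pderiv i P) := fun x => by
    have hc : coeE e = Pi.single i 1 := by
      funext j
      rw [coeE_apply, he, PiLp.single_apply, Pi.single_apply]
      split_ifs <;> simp
    have hd : dirD (Pi.single i 1) P = pderiv i P := by
      rw [dirD_apply, Finset.sum_eq_single i] <;> simp +contextual
    rw [(hasFDerivAt_eval_coeE P x).fderiv]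
    simp [hc, gradAt_apply, hd]
  have h2 : ∀ x, fderiv ℝ gauss x e = -(coeE x i * gauss x) := fun x => by
    rw [(hasFDerivAt_gauss x).fderiv]
    simp [he, EuclideanSpace.inner_single_right, coeE_apply]
    ring
  have h3 : ∀ x, eval (coeE x) P * fderiv ℝ gauss x e = -(eval (coeE x) (X i * P) * gauss x) :=
    fun x => by rw [h2, map_mul, eval_X]; ring
  have key := integral_mul_fderiv_eq_neg_fderiv_mul_of_integrable (μ := volume)
    (f := fun x : EuclideanSpace ℝ (Fin 3) => eval (coeE x) P) (g := gauss) (v := e)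
    (by simp only [h1]; exact integrable_eval_mul_gauss _)
    (by simp only [h3]; exact (integrable_eval_mul_gauss _).neg)
    (integrable_eval_mul_gauss P)
    (fun x _ => (hasFDerivAt_eval_coeE P x).differentiableAt)
    (fun x _ => (hasFDerivAt_gauss x).differentiableAt)
  simp only [h1, h3, integral_neg] at key
  rw [gaussInt_apply, gaussInt_apply]
  exact (neg_injective key).symm

theorem lap_one_apply (P : MvPolynomial (Fin 3) ℂ) :
    lap 1 P = ∑ i, pderiv i (pderiv i P) := by
  simp [lap_apply, Matrix.one_apply]

/-- The field H∇G - G∇H is divergence free, while its scalar product with x is (b-a)HG by Euler.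
Integration by parts against the Gaussian equates the integrals of the two. -/
theorem gaussInt_mul_eq_zero {a b : ℕ} (hab : a ≠ b) {H G : MvPolynomial (Fin 3) ℂ}
    (hH : IsHarm 1 a H) (hG : IsHarm 1 b G) : gaussInt (H * G) = 0 := by
  have h1 : ∑ i, pderiv i (H * pderiv i G - G * pderiv i H) = 0 := by
    have e1 := hH.lap_eq
    have e2 := hG.lap_eq
    rw [lap_one_apply] at e1 e2
    have : ∑ i, pderiv i (H * pderiv i G - G * pderiv i H) =
        H * ∑ i, pderiv i (pderiv i G) - G * ∑ i, pderiv i (pderiv i H) := by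
      rw [Finset.mul_sum, Finset.mul_sum, ← Finset.sum_sub_distrib]
      refine Finset.sum_congr rfl fun i _ => ?_
      rw [map_sub, pderiv_mul, pderiv_mul]; ring
    rw [this, e1, e2, mul_zero, mul_zero, sub_zero]
  have h2 : ∑ i, X i * (H * pderiv i G - G * pderiv i H) = C ((b : ℂ) - a) * (H * G) := by
    have e1 := hH.hom.sum_X_mul_pderiv
    have e2 := hG.hom.sum_X_mul_pderiv
    have : ∑ i, X i * (H * pderiv i G - G * pderiv i H) =
        H * ∑ i, X i * pderiv i G - G * ∑ i, X i * pderiv i H := by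
      rw [Finset.mul_sum, Finset.mul_sum, ← Finset.sum_sub_distrib]
      exact Finset.sum_congr rfl fun i _ => by ring
    rw [this, e1, e2, map_sub, map_natCast, map_natCast, nsmul_eq_mul, nsmul_eq_mul]; ring
  have h3 := congrArg gaussInt h1
  simp only [map_sum, gaussInt_pderiv, map_zero] at h3
  rw [← map_sum, h2, ← smul_eq_C_mul, map_smul, smul_eq_mul] at h3
  refine (mul_eq_zero.1 h3).resolve_left ?_
  exact sub_ne_zero.2 (by exact_mod_cast hab.symm)

/-- The radial factor in the Gaussian integral of a form of degree `n`. -/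
noncomputable def radial (n : ℕ) : ℝ :=
  ∫ r : Set.Ioi (0 : ℝ), (r : ℝ) ^ n * Real.exp (-(r : ℝ) ^ 2 / 2) ∂Measure.volumeIoiPow 2

theorem radial_pos (n : ℕ) : 0 < radial n := by
  -- The exponent n + 2 includes the r² of the polar measure.
  have h : radial n = ∫ r in Set.Ioi (0 : ℝ), r ^ (((n + 2 : ℕ) : ℝ)) * Real.exp (-(1 / 2) * r ^ (2 : ℝ)) := by
    simp only [radial, Measure.volumeIoiPow, ENNReal.ofReal]
    rw [integral_withDensity_eq_integral_smul (measurable_subtype_coe.pow_const _).real_toNNReal,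
      integral_subtype_comap measurableSet_Ioi
        fun a : ℝ ↦ Real.toNNReal (a ^ 2) • (a ^ n * Real.exp (-a ^ 2 / 2))]
    refine setIntegral_congr_fun measurableSet_Ioi fun x hx => ?_
    rw [NNReal.smul_def, Real.coe_toNNReal _ (pow_nonneg (le_of_lt hx) _), Real.rpow_natCast,
      Real.rpow_two, smul_eq_mul, show -x ^ 2 / 2 = -(1 / 2) * x ^ 2 by ring]
    ring
  rw [h, integral_rpow_mul_exp_neg_mul_rpow two_pos
    (by linarith [(Nat.cast_nonneg (n + 2) : (0 : ℝ) ≤ _)]) (by norm_num)]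
  have : 0 < Real.Gamma ((((n + 2 : ℕ) : ℝ) + 1) / 2) := Real.Gamma_pos_of_pos (by positivity)
  positivity

/-- In polar coordinates homogeneity separates r^n, so spherical and Gaussian integrals differ by a
positive factor. -/
theorem gaussInt_eq_radial_mul {n : ℕ} {P : MvPolynomial (Fin 3) ℂ} (hP : P.IsHomogeneous n) :
    gaussInt P = (∫ v : Metric.sphere (0 : EuclideanSpace ℝ (Fin 3)) 1, eval (coeE v) P
      ∂((volume : Measure (EuclideanSpace ℝ (Fin 3))).toSphere)) * (radial n : ℂ) := by
  have h1 := (volume : Measure (EuclideanSpace ℝ (Fin 3))).measurePreserving_homeomorphUnitSphereProd.integral_comp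
    (Homeomorph.measurableEmbedding _)
    (fun z : Metric.sphere (0 : EuclideanSpace ℝ (Fin 3)) 1 × Set.Ioi (0 : ℝ) => eval (coeE z.1) P *
      (((z.2 : ℝ) ^ n * Real.exp (-(z.2 : ℝ) ^ 2 / 2) : ℝ) : ℂ))
  rw [integral_prod_mul (fun v : Metric.sphere (0 : EuclideanSpace ℝ (Fin 3)) 1 => eval (coeE v) P)
    (fun r : Set.Ioi (0 : ℝ) => (((r : ℝ) ^ n * Real.exp (-(r : ℝ) ^ 2 / 2) : ℝ) : ℂ)),
    integral_complex_ofReal (f := fun r : Set.Ioi (0 : ℝ) =>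
      (r : ℝ) ^ n * Real.exp (-(r : ℝ) ^ 2 / 2)), finrank_euclideanSpace, Fintype.card_fin] at h1
  have h0 : gaussInt P = ∫ x : ({0}ᶜ : Set (EuclideanSpace ℝ (Fin 3))),
      eval (coeE x) P * gauss x ∂(Measure.comap Subtype.val volume) := by
    rw [integral_subtype_comap (measurableSet_singleton _).compl
      fun x : EuclideanSpace ℝ (Fin 3) => eval (coeE x) P * gauss x, restrict_compl_singleton,
      gaussInt_apply]
  rw [radial, ← h1, h0]
  refine integral_congr_ae (Filter.Eventually.of_forall fun x => ?_)
  have hx : ‖(x : EuclideanSpace ℝ (Fin 3))‖ ≠ 0 := norm_ne_zero_iff.2 x.2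
  simp only [homeomorphUnitSphereProd_apply_fst_coe, homeomorphUnitSphereProd_apply_snd_coe]
  have h2 : coeE (x : EuclideanSpace ℝ (Fin 3)) =
      ((‖(x : EuclideanSpace ℝ (Fin 3))‖ : ℝ) : ℂ) •
        coeE (‖(x : EuclideanSpace ℝ (Fin 3))‖⁻¹ • (x : EuclideanSpace ℝ (Fin 3))) := by
    funext i
    simp [coeE_apply, hx]
  rw [h2, eval_smul_of_isHomogeneous hP, gauss]
  push_cast
  ring

theorem sphere_integral_mul_eq_zero {a b : ℕ} (hab : a ≠ b) {H G : MvPolynomial (Fin 3) ℂ}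
    (hH : IsHarm 1 a H) (hG : IsHarm 1 b G) :
    ∫ v : Metric.sphere (0 : EuclideanSpace ℝ (Fin 3)) 1, eval (coeE v) H * eval (coeE v) G
      ∂((volume : Measure (EuclideanSpace ℝ (Fin 3))).toSphere) = 0 := by
  have h1 := gaussInt_eq_radial_mul (hH.hom.mul hG.hom)
  rw [gaussInt_mul_eq_zero hab hH hG] at h1
  have h2 := (mul_eq_zero.1 h1.symm).resolve_right (by exact_mod_cast (radial_pos _).ne')
  simpa using h2

end Gaussian

/-! ### Orthogonality for a general normalization A -/

section Orthogonality

/-- The operator with B = 1 has real coefficients; conjugating coefficients reduces the Hermitian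
pairing to the bilinear one. -/
theorem isHarm_map_conj {n : ℕ} {P : MvPolynomial (Fin 3) ℂ} (h : IsHarm 1 n P) :
    IsHarm 1 n (MvPolynomial.map (starRingEnd ℂ) P) := by
  refine ⟨h.hom.map _, ?_⟩
  have h1 := h.lap_eq
  rw [lap_one_apply] at h1 ⊢
  simp only [pderiv_map, ← map_sum, h1, map_zero]

theorem eval_coeE_map_conj (P : MvPolynomial (Fin 3) ℂ) (x : EuclideanSpace ℝ (Fin 3)) :
    eval (coeE x) (MvPolynomial.map (starRingEnd ℂ) P) = conj (eval (coeE x) P) := by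
  have h : (eval (coeE x)).comp (MvPolynomial.map (starRingEnd ℂ)) =
      (starRingEnd ℂ).comp (eval (coeE x)) := by
    refine ringHom_ext (fun a => by simp) fun i => ?_
    simp [coeE_apply]
  exact RingHom.congr_fun h P

/-- After the substitution A⁻¹ the powers of Q equal 1 on the sphere, leaving two ordinary harmonic
polynomials of different degrees. -/
theorem sphereInner_eq_zero {B : Matrix (Fin 3) (Fin 3) ℝ} (hdet : B.det ≠ 0)
    {A : Matrix (Fin 3) (Fin 3) ℂ} (hA : A * Aᵀ = B.map (algebraMap ℝ ℂ)) {a b k l : ℕ}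
    (hab : a ≠ b) {h g : MvPolynomial (Fin 3) ℝ} (hh : IsHarm B a h) (hg : IsHarm B b g) :
    sphereInner A (qf B ^ k * h) (qf B ^ l * g) = 0 := by
  have hAd : A.det ≠ 0 := by
    intro h0
    have := congrArg Matrix.det hA
    rw [Matrix.det_mul, h0, zero_mul] at this
    exact det_map_ne_zero hdet this.symm
  have hAu := isUnit_iff_ne_zero.2 hAd
  have hAi : A⁻¹.det ≠ 0 := by
    rw [Matrix.det_nonsing_inv]; simpa using hAd
  have hN : A⁻¹ * B.map (algebraMap ℝ ℂ) * A⁻¹ᵀ = 1 := by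
    rw [← hA, ← Matrix.mul_assoc, Matrix.nonsing_inv_mul _ hAu, Matrix.one_mul,
      ← Matrix.transpose_mul, Matrix.nonsing_inv_mul _ hAu, Matrix.transpose_one]
  have hharm : ∀ {n : ℕ} {p : MvPolynomial (Fin 3) ℝ}, IsHarm B n p →
      IsHarm 1 n (subst A⁻¹ (MvPolynomial.map (algebraMap ℝ ℂ) p)) := fun hp =>
    ⟨isHomogeneous_subst _ (hp.map hdet).hom, by
      rw [← hN, lap_subst hAi, (hp.map hdet).lap_eq, map_zero]⟩
  have hev : ∀ (v : Metric.sphere (0 : EuclideanSpace ℝ (Fin 3)) 1) (m : ℕ)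
      (p : MvPolynomial (Fin 3) ℝ),
      aeval ((fun i => (((v : EuclideanSpace ℝ (Fin 3)) i : ℝ) : ℂ)) ᵥ* A⁻¹) (qf B ^ m * p) =
        eval (coeE v) (subst A⁻¹ (MvPolynomial.map (algebraMap ℝ ℂ) p)) := by
    intro v m p
    have h1 : eval (coeE v) (qf (1 : Matrix (Fin 3) (Fin 3) ℂ)) = 1 := by
      have h2 := EuclideanSpace.real_norm_sq_eq (v : EuclideanSpace ℝ (Fin 3))
      rw [mem_sphere_zero_iff_norm.1 v.2] at h2
      rw [eval_qf, Matrix.vecMul_one, dotProduct]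
      simp only [coeE_apply, ← pow_two]
      exact_mod_cast h2.symm.trans (one_pow 2)
    change aeval (coeE v ᵥ* A⁻¹) _ = _
    rw [aeval_def, ← eval_map, ← eval_subst, map_mul, map_pow, map_qf, map_mul, map_pow, subst_qf,
      hN, map_mul, map_pow, h1, one_pow, one_mul]
  rw [sphereInner]
  simp only [hev, ← eval_coeE_map_conj]
  rw [sphere_integral_mul_eq_zero hab (hharm hh) (isHarm_map_conj (hharm hg)), Complex.zero_re]

end Orthogonality

/-! ### The summands and the Dirichlet problem -/

section Summands

variable {B : Matrix (Fin 3) (Fin 3) ℝ}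

theorem mem_harm_iff {n : ℕ} {P : MvPolynomial (Fin 3) ℝ} : P ∈ harm B n ↔ IsHarm B n P :=
  ⟨fun h => ⟨h.1, h.2⟩, fun h => ⟨h.hom, h.lap_eq⟩⟩

theorem mem_summand_iff {d k : ℕ} {P : MvPolynomial (Fin 3) ℝ} :
    P ∈ summand B d k ↔ ∃ h, IsHarm B (d - 2 * k) h ∧ qf B ^ k * h = P := by
  simp only [summand, Submodule.mem_map, mem_harm_iff]
  rfl

theorem iSupIndep_summand (hB : B.IsSymm) (hdet : B.det ≠ 0) (d : ℕ) :
    iSupIndep fun k : Fin (d / 2 + 1) => summand B d k := by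
  refine ((Module.End.eigenspaces_iSupIndep
    (LinearMap.mulLeft ℝ (qf B) ∘ₗ lap B : Module.End ℝ (MvPolynomial (Fin 3) ℝ))).comp
      (eigenvalue_injective (K := ℝ) d)).mono fun k P hP => ?_
  obtain ⟨h, hh, rfl⟩ := mem_summand_iff.1 hP
  rw [Function.comp_apply, Module.End.mem_eigenspace_iff]
  exact qf_mul_lap_qf_pow_mul hB hdet (by omega) hh

theorem iSup_summand (hB : B.IsSymm) (hdet : B.det ≠ 0) (d : ℕ) :
    ⨆ k : Fin (d / 2 + 1), summand B d k = homogeneousSubmodule (Fin 3) ℝ d := by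
  refine le_antisymm (iSup_le fun k P hP => ?_) fun P hP => ?_
  · obtain ⟨h, hh, rfl⟩ := mem_summand_iff.1 hP
    have := ((isHomogeneous_qf B).pow k).mul hh.hom
    rwa [show 2 * (k : ℕ) + (d - 2 * k) = d by omega] at this
  · obtain ⟨h, hh, rfl⟩ := mem_span_qf_pow_mul hB hdet d P hP
    rw [← Fin.sum_univ_eq_sum_range fun k => qf B ^ k * h k]
    refine Submodule.sum_mem _ fun k _ => ?_
    exact Submodule.mem_iSup_of_mem k (mem_summand_iff.2 ⟨h k, hh k (by omega), rfl⟩)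

theorem map_act_summand {U : GL (Fin 3) ℝ} (hU : U ∈ orthoGroup B) (d k : ℕ) :
    (summand B d k).map (act (U : Matrix (Fin 3) (Fin 3) ℝ)) = summand B d k := by
  have key : ∀ V ∈ orthoGroup B, ∀ P ∈ summand B d k,
      subst (V : Matrix (Fin 3) (Fin 3) ℝ) P ∈ summand B d k := by
    intro V hV P hP
    have hV' : (V : Matrix (Fin 3) (Fin 3) ℝ) * B * (V : Matrix (Fin 3) (Fin 3) ℝ)ᵀ = B := hV
    have hVd : (V : Matrix (Fin 3) (Fin 3) ℝ).det ≠ 0 :=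
      ((Matrix.isUnit_iff_isUnit_det _).1 V.isUnit).ne_zero
    obtain ⟨h, hh, rfl⟩ := mem_summand_iff.1 hP
    refine mem_summand_iff.2 ⟨subst V h, ⟨isHomogeneous_subst _ hh.hom, ?_⟩, ?_⟩
    · have := lap_subst (B := B) hVd h
      rwa [hV', hh.lap_eq, map_zero] at this
    · rw [map_mul, map_pow, subst_qf, hV']
  refine le_antisymm ?_ fun P hP => ?_
  · rintro _ ⟨P, hP, rfl⟩
    exact key U hU P hP
  -- Stability under U⁻¹ upgrades the inclusion to an equality.
  · refine ⟨_, key U⁻¹ (inv_mem hU) P hP, ?_⟩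
    change subst (U : Matrix (Fin 3) (Fin 3) ℝ) _ = P
    rw [subst_subst, ← Units.val_mul, mul_inv_cancel, Units.val_one, subst_one]

theorem sphereInner_summand (hdet : B.det ≠ 0)
    {A : Matrix (Fin 3) (Fin 3) ℂ} (hA : A * Aᵀ = B.map (fun x : ℝ => (x : ℂ))) {d k l : ℕ}
    (hk : 2 * k ≤ d) (hl : 2 * l ≤ d) (hkl : k ≠ l) {f g : MvPolynomial (Fin 3) ℝ}
    (hf : f ∈ summand B d k) (hg : g ∈ summand B d l) : sphereInner A f g = 0 := by
  obtain ⟨h, hh, rfl⟩ := mem_summand_iff.1 hf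
  obtain ⟨h', hh', rfl⟩ := mem_summand_iff.1 hg
  exact sphereInner_eq_zero hdet hA (by omega) hh hh'

theorem exists_dirichlet (hB : B.IsSymm) (hdet : B.det ≠ 0) (c : ℝ)
    (M N : MvPolynomial (Fin 3) ℝ) : ∃ P, lapl B P = M ∧
      ∀ v : Fin 3 → ℝ, eval v (quadPoly B) = c → eval v P = eval v N := by
  -- Adding (Q-c)R to N keeps the boundary values, so R only has to correct ΔN to M.
  obtain ⟨R, hR⟩ := exists_lap_qf_sub_mul_eq hB hdet c (M - lap B N)
  refine ⟨N + (qf B - C c) * R, ?_, fun v hv => ?_⟩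
  · change lap B _ = M
    rw [map_add, hR, add_sub_cancel]
  · change eval v (qf B) = c at hv
    rw [map_add, map_mul, map_sub, hv, eval_C, sub_self, zero_mul, add_zero]

theorem dirichlet_unique (hB : B.IsSymm) (hdet : B.det ≠ 0) {c : ℝ} {v : Fin 3 → ℝ} (hv : v ≠ 0)
    (hvc : eval v (quadPoly B) = c) {P R : MvPolynomial (Fin 3) ℝ} (hl : lapl B P = lapl B R)
    (h : ∀ v : Fin 3 → ℝ, eval v (quadPoly B) = c → eval v P = eval v R) : P = R := by
  refine sub_eq_zero.1 (eq_zero_of_vanish hB hdet c hv hvc (P := P - R) ?_ fun w hw => ?_)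
  · change lapl B (P - R) = 0
    rw [map_sub, hl, sub_self]
  · rw [map_sub, h w hw, sub_self]

end Summands

end QHarm

theorem theorem17 (B : Matrix (Fin 3) (Fin 3) ℝ) (hB : B.IsSymm) (hdet : B.det ≠ 0) :
    -- the invariant orthogonal decomposition
    (∀ d : ℕ,
      (iSupIndep fun k : Fin (d / 2 + 1) => QHarm.summand B d k) ∧
      (⨆ k : Fin (d / 2 + 1), QHarm.summand B d k) = homogeneousSubmodule (Fin 3) ℝ d ∧
      (∀ U ∈ QHarm.orthoGroup B, ∀ k : Fin (d / 2 + 1),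
        (QHarm.summand B d k).map (QHarm.act (U : Matrix (Fin 3) (Fin 3) ℝ)) =
          QHarm.summand B d k) ∧
      (∀ A : Matrix (Fin 3) (Fin 3) ℂ, A * Aᵀ = B.map (fun x : ℝ => (x : ℂ)) →
        ∀ k l : Fin (d / 2 + 1), k ≠ l →
          ∀ f ∈ QHarm.summand B d k, ∀ g ∈ QHarm.summand B d l, QHarm.sphereInner A f g = 0)) ∧
    -- polynomial functions on `{Q = c}` are restrictions of `Q`-harmonic polynomials
    (∀ (c : ℝ) (F : MvPolynomial (Fin 3) ℝ), ∃ P : MvPolynomial (Fin 3) ℝ,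
      QHarm.lapl B P = 0 ∧
      ∀ v : Fin 3 → ℝ, eval v (QHarm.quadPoly B) = c → eval v P = eval v F) ∧
    -- the Dirichlet problem: existence, and uniqueness if `{Q = c}` is not contained in `{0}`
    (∀ (c : ℝ) (M N : MvPolynomial (Fin 3) ℝ),
      (∃ P : MvPolynomial (Fin 3) ℝ, QHarm.lapl B P = M ∧
        ∀ v : Fin 3 → ℝ, eval v (QHarm.quadPoly B) = c → eval v P = eval v N) ∧
      ((∃ v : Fin 3 → ℝ, v ≠ 0 ∧ eval v (QHarm.quadPoly B) = c) →
        ∃! P : MvPolynomial (Fin 3) ℝ, QHarm.lapl B P = M ∧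
          ∀ v : Fin 3 → ℝ, eval v (QHarm.quadPoly B) = c → eval v P = eval v N)) ∧
    -- the Maxwell-type representation
    (∀ (d : ℕ) (P : MvPolynomial (Fin 3) ℝ), P ∈ homogeneousSubmodule (Fin 3) ℝ d →
      (∃ (u : (k : ℕ) → Fin (d - 2 * k) → Fin 3 → ℂ) (lam : ℝ), QHarm.MaxwellRep B d P u lam) ∧
      (B.PosDef →
        (∃ (u : (k : ℕ) → Fin (d - 2 * k) → Fin 3 → ℝ) (lam : ℝ),
          QHarm.MaxwellRep B d P (fun k j i => (u k j i : ℂ)) lam) ∧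
        (∀ (u u' : (k : ℕ) → Fin (d - 2 * k) → Fin 3 → ℝ) (lam lam' : ℝ),
          QHarm.MaxwellRep B d P (fun k j i => (u k j i : ℂ)) lam →
          QHarm.MaxwellRep B d P (fun k j i => (u' k j i : ℂ)) lam' →
            (∀ k : ℕ, 2 * k < d → QHarm.SameMultipole (u k) (u' k)) ∧
            (Even d → lam = lam')))) := by
  refine ⟨fun d => ⟨QHarm.iSupIndep_summand hB hdet d, QHarm.iSup_summand hB hdet d,
    fun U hU k => QHarm.map_act_summand hU d k, fun A hA k l hkl f hf g hg =>
      QHarm.sphereInner_summand hdet hA (by omega) (by omega) (fun h => hkl (Fin.ext h)) hf hg⟩,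
    fun c F => QHarm.exists_dirichlet hB hdet c 0 F,
    fun c M N => ⟨QHarm.exists_dirichlet hB hdet c M N, ?_⟩, fun d P hP => ⟨?_, fun hpos => ?_⟩⟩
  · rintro ⟨v, hv, hvc⟩
    obtain ⟨P, hP, hPN⟩ := QHarm.exists_dirichlet hB hdet c M N
    exact ⟨P, ⟨hP, hPN⟩, fun R hR => QHarm.dirichlet_unique hB hdet hv hvc (hR.1.trans hP.symm)
      fun w hw => (hR.2 w hw).trans (hPN w hw).symm⟩
  · obtain ⟨E, hE⟩ := QHarm.exists_normalization hB hdet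
    exact QHarm.exists_maxwellRep hB hdet (fun u => u) (fun n H hH =>
      (hH.map hdet).exists_eq_maxw (hB.map _) (QHarm.det_map_ne_zero hdet) hE) hP
  · obtain ⟨E, hE⟩ := QHarm.exists_real_normalization hpos
    exact ⟨QHarm.exists_maxwellRep hB hdet QHarm.toC (fun n H hH =>
      hH.exists_eq_maxw_real hB hdet hE) hP,
      fun u u' lam lam' h h' => QHarm.maxwellRep_unique hB hdet hE h h'⟩
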